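/- Let $\mathbb D=\{z\in\mathbb C:|z|<1\}$ and let $\mathbf h^2$ be the space of complex-valued harmonic functions $f$ on $\mathbb D$ for which $\frac1{2\pi}\int_0^{2\pi}|f(re^{i\theta})|^2\,d\theta$ is bounded uniformly in $0\le r<1$. Write $f=h+\overline g$ with $h,g$ analytic in $\mathbb D$ and $g(0)=0$. For a function $F$ on $\mathbb D$ let $F(e^{i\theta})=\lim_{r\to1^-}F(re^{i\theta})$ denote its radial limit, and put $$\|hg\|_1=\int_0^{2\pi}|h(e^{i\theta})g(e^{i\theta})|\,d\theta ,$$ where $h(e^{i\theta})g(e^{i\theta})$ is the radial limit of the product $hg$. If $f=h+\overline g\in\mathbf h^2$, then the radial limits of $f$ and of $hg$ exist for almost every $\theta$, all integrals below converge, and for all $t\in\mathbb R$ $$\int_{-1}^{1}|f(xe^{it})|^2\,dx\;\le\;\frac12\int_0^{2\pi}|f(e^{i\theta})|^2\,d\theta+\|hg\|_1\;\le\;\int_0^{2\pi}|f(e^{i\theta})|^2\,d\theta .$$ Both inequalities are sharp: for every $t\in\mathbb R$ and every $C<1$ there is $f=h+\overline g\in\mathbf h^2$ (with $g(0)=0$)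 such that simultaneously $$\int_{-1}^{1}|f(xe^{it})|^2\,dx> C\Bigl(\frac12\int_0^{2\pi}|f(e^{i\theta})|^2\,d\theta+\|hg\|_1\Bigr)\quad\text{and}\quad \frac12\int_0^{2\pi}|f(e^{i\theta})|^2\,d\theta+\|hg\|_1> C\int_0^{2\pi}|f(e^{i\theta})|^2\,d\theta .$$ -/

import Mathlib

open MeasureTheory Filter Topology

noncomputable section

/-- The integral mean `M_p(r, f) = ((1/2π) ∫_0^{2π} |f(r e^{iθ})|^p dθ)^{1/p}`. -/
def integralMean (p r : ℝ) (f : ℂ → ℂ) : ℝ :=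
  ((1 / (2 * Real.pi)) *
    ∫ θ in (0 : ℝ)..(2 * Real.pi), ‖f ((r : ℂ) * Complex.exp ((θ : ℂ) * Complex.I))‖ ^ p) ^ (1 / p)

/-- The harmonic Hardy space `h^p`: complex-valued harmonic functions on the open unit disk whose
integral means `M_p(r, f)`, `0 ≤ r < 1`, are uniformly bounded. Values of `f` outside of the disk
are irrelevant. -/
structure MemHarmonicHardy (p : ℝ) (f : ℂ → ℂ) : Prop where
  harmonic : InnerProductSpace.HarmonicOnNhd f (Metric.ball (0 : ℂ) 1)
  bounded : ∃ M : ℝ, ∀ r : ℝ, 0 ≤ r → r < 1 → integralMean p r f ≤ M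

/-- The decomposition `f = h + conj g` in the unit disk, with `h`, `g` analytic there, normalized
by `g(0) = 0`. -/
structure IsCanonicalDecomposition (f h g : ℂ → ℂ) : Prop where
  analytic_h : DifferentiableOn ℂ h (Metric.ball (0 : ℂ) 1)
  analytic_g : DifferentiableOn ℂ g (Metric.ball (0 : ℂ) 1)
  normalized : g 0 = 0
  eq_on_disk : ∀ z ∈ Metric.ball (0 : ℂ) 1, f z = h z + (starRingEnd ℂ) (g z)

/-- `F` has the radial limit `w` at the boundary point `e^{iθ}`. -/
def HasRadialLimit (F : ℂ → ℂ) (θ : ℝ) (w : ℂ) : Prop :=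
  Tendsto (fun r : ℝ => F ((r : ℂ) * Complex.exp ((θ : ℂ) * Complex.I))) (𝓝[<] (1 : ℝ)) (𝓝 w)

/-- The boundary value `F(e^{iθ})`, that is, the radial limit of `F` at `e^{iθ}` (a meaningless
default value if that limit does not exist). -/
def boundaryValue (F : ℂ → ℂ) (θ : ℝ) : ℂ :=
  limUnder (𝓝[<] (1 : ℝ)) (fun r : ℝ => F ((r : ℂ) * Complex.exp ((θ : ℂ) * Complex.I)))

/-- `∫_{-1}^{1} |f(x e^{it})|² dx`. -/
def diameterIntegral (f : ℂ → ℂ) (t : ℝ) : ℝ :=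
  ∫ x in (-1 : ℝ)..1, ‖f ((x : ℂ) * Complex.exp ((t : ℂ) * Complex.I))‖ ^ 2

/-- `∫_0^{2π} |f(e^{iθ})|² dθ`. -/
def boundarySqIntegral (f : ℂ → ℂ) : ℝ :=
  ∫ θ in (0 : ℝ)..(2 * Real.pi), ‖boundaryValue f θ‖ ^ 2

/-- `∫_0^{2π} |h(e^{iθ}) g(e^{iθ})| dθ`: the unnormalized `L¹` norm of the boundary function
of `h g`. -/
def prodL1Norm (h g : ℂ → ℂ) : ℝ :=
  ∫ θ in (0 : ℝ)..(2 * Real.pi), ‖boundaryValue (fun z => h z * g z) θ‖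

end

/-!
The engine is the Fejér–Riesz inequality `∫_{-ρ}^{ρ} |F|^p ≤ (1/2) ∫_{|z| = ρ} |F|^p |dz|` for `F`
analytic on a closed disk of radius `ρ`. Since `|f|² ≤ |h|² + |g|² + 2|hg|`, it applies to `h` and
`g` with `p = 2` and to `hg` with `p = 1`. On the circle, the integral of `|h|² + |g|²` is that of
`|f|²`, because `∫ hg = 0` by the mean value property and `g 0 = 0`. Letting `ρ → 1` uses that the
dilations of `h` and `g` converge in `L²` of the circle, and the boundary functions so obtained are
radial limits by Fatou's theorem. The second inequality is `2|hg| ≤ |h|² + |g|²`.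

For sharpness, take `h = (R - cz)^{-1/2}` and `g = cz h` with `c = e^{-it}`: the second inequality
is an equality, and as `R ↓ 1` both sides of the first one are asymptotic to `4 log (1 / (R - 1))`.
-/

noncomputable section

section FejerRiesz

open Complex Metric
open scoped ComplexConjugate Polynomial Real

theorem exists_polynomial_norm_sub_lt {F : ℂ → ℂ} (hF : DiffContOnCl ℂ F (ball 0 1)) {ε : ℝ}
    (hε : 0 < ε) : ∃ P : ℂ[X], ∀ z ∈ closedBall (0 : ℂ) 1, ‖F z - P.eval z‖ < ε := by
  obtain ⟨δ, hδ, hclose⟩ := uniformContinuousOn_iff.1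
    ((isCompact_closedBall (0 : ℂ) 1).uniformContinuousOn_of_continuous hF.continuousOn_ball)
    (ε / 2) (half_pos hε)
  obtain ⟨r, hr, hr1⟩ := exists_between (max_lt (sub_lt_self (1 : ℝ) hδ) one_pos)
  obtain ⟨hrδ, hr0⟩ := max_lt_iff.1 hr
  obtain ⟨s, hrs, hs1⟩ := exists_between hr1
  lift s to NNReal using (hr0.trans hrs).le
  have hTaylor := DiffContOnCl.hasFPowerSeriesOnBall (R := 1) (by simpa using hF) one_pos
  obtain ⟨n, hn⟩ := (tendstoUniformlyOn_iff.1 (hTaylor.tendstoUniformlyOn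
    (r' := s) (by exact_mod_cast hs1)) (ε / 2) (half_pos hε)).exists
  refine ⟨∑ i ∈ Finset.range n, Polynomial.C ((cauchyPowerSeries F 0 (1 : NNReal)).coeff i) *
    (Polynomial.C (r : ℂ) * Polynomial.X) ^ i, fun z hz => ?_⟩
  have hrz : ‖(r : ℂ) * z‖ ≤ r := by
    rw [norm_mul, norm_real, Real.norm_of_nonneg hr0.le]
    exact mul_le_of_le_one_right hr0.le (by simpa using hz)
  have hdilate : dist (F z) (F (r * z)) < ε / 2 := by
    refine hclose _ hz _ (mem_closedBall_zero_iff.2 (hrz.trans hr1.le)) ?_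
    calc dist z (r * z) = (1 - r) * ‖z‖ := by
          rw [dist_eq_norm, ← one_sub_mul, norm_mul, ← ofReal_one, ← ofReal_sub, norm_real,
            Real.norm_of_nonneg (by linarith)]
      _ ≤ 1 - r := mul_le_of_le_one_right (by linarith) (by simpa using hz)
      _ < δ := by linarith
  have hpartial := hn (r * z) (mem_ball_zero_iff.2 (hrz.trans_lt hrs))
  simp only [zero_add, FormalMultilinearSeries.partialSum,
    FormalMultilinearSeries.apply_eq_pow_smul_coeff, smul_eq_mul] at hpartial
  simp only [Polynomial.eval_finsetSum, Polynomial.eval_mul, Polynomial.eval_C,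
    Polynomial.eval_pow, Polynomial.eval_X, ← dist_eq_norm, mul_comm _ ((_ : ℂ) ^ _)]
  exact (dist_triangle _ _ _).trans_lt (by linarith)

theorem tendsto_intervalIntegral_norm_rpow {f : ℕ → ℂ → ℂ} {F : ℂ → ℂ} {p : ℝ} (hp : 0 ≤ p)
    {K : Set ℂ} (hK : IsCompact K) (hf : ∀ n, ContinuousOn (f n) K) (hF : ContinuousOn F K)
    (hlim : TendstoUniformlyOn f F atTop K) {γ : ℝ → ℂ} (hγ : Continuous γ) {a b : ℝ}
    (hγK : ∀ x ∈ Set.uIoc a b, γ x ∈ K) :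
    Tendsto (fun n => ∫ x in a..b, ‖f n (γ x)‖ ^ p) atTop
      (𝓝 (∫ x in a..b, ‖F (γ x)‖ ^ p)) := by
  obtain ⟨B, hB⟩ := hK.exists_bound_of_continuousOn hF
  refine intervalIntegral.tendsto_integral_filter_of_dominated_convergence
    (fun _ => (B + 1) ^ p) (.of_forall fun n => ?_) ?_ (by simp) (ae_of_all _ fun x hx => ?_)
  · have : ContinuousOn (fun x => f n (γ x)) (Set.uIoc a b) := (hf n).comp hγ.continuousOn hγK
    exact (this.norm.rpow_const fun _ _ => Or.inr hp).aestronglyMeasurable measurableSet_uIoc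
  · filter_upwards [Metric.tendstoUniformlyOn_iff.1 hlim 1 one_pos] with n hn
    refine ae_of_all _ fun x hx => ?_
    rw [Real.norm_of_nonneg (by positivity)]
    refine Real.rpow_le_rpow (norm_nonneg _) ?_ hp
    have hdist := hn _ (hγK x hx)
    rw [dist_comm, dist_eq_norm] at hdist
    linarith [norm_le_norm_add_norm_sub' (f n (γ x)) (F (γ x)), hB _ (hγK x hx)]
  · exact (hlim.tendsto_at (hγK x hx)).norm.rpow_const (Or.inr hp)

theorem ofReal_mem_closedBall_of_mem_uIoc {x : ℝ} (hx : x ∈ Set.uIoc (-1) 1) :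
    (x : ℂ) ∈ closedBall 0 1 := by
  rw [Set.uIoc_of_le (by norm_num)] at hx
  simpa using abs_le.2 ⟨hx.1.le, hx.2⟩

theorem fejerRiesz_of_forall_polynomial {p : ℝ} (hp : 0 ≤ p)
    (hpoly : ∀ P : ℂ[X], ∫ x in (-1 : ℝ)..1, ‖P.eval (x : ℂ)‖ ^ p
      ≤ 1 / 2 * ∫ θ in (0 : ℝ)..(2 * π), ‖P.eval (circleMap 0 1 θ)‖ ^ p)
    {F : ℂ → ℂ} (hF : DiffContOnCl ℂ F (ball 0 1)) :
    ∫ x in (-1 : ℝ)..1, ‖F x‖ ^ p ≤ 1 / 2 * ∫ θ in (0 : ℝ)..(2 * π), ‖F (circleMap 0 1 θ)‖ ^ p := by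
  choose P hP using fun n : ℕ =>
    exists_polynomial_norm_sub_lt hF (one_div_pos.2 (n.cast_add_one_pos (α := ℝ)))
  have hlim : TendstoUniformlyOn (fun n z => (P n).eval z) F atTop (closedBall 0 1) := by
    refine tendstoUniformlyOn_iff.2 fun ε hε => ?_
    filter_upwards [(tendsto_one_div_add_atTop_nhds_zero_nat (𝕜 := ℝ)).eventually_lt_const hε]
      with n hn z hz
    exact (dist_eq_norm (F z) _ ▸ hP n z hz).trans hn
  have htendsto {γ : ℝ → ℂ} (hγ : Continuous γ) {a b : ℝ}
      (hγ1 : ∀ x ∈ Set.uIoc a b, γ x ∈ closedBall 0 1) :=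
    tendsto_intervalIntegral_norm_rpow hp (isCompact_closedBall (0 : ℂ) 1)
      (fun n => (P n).continuousOn) hF.continuousOn_ball hlim hγ hγ1
  exact le_of_tendsto_of_tendsto'
    (htendsto continuous_ofReal fun x => ofReal_mem_closedBall_of_mem_uIoc)
    ((htendsto (continuous_circleMap 0 1) fun θ _ =>
      circleMap_mem_closedBall 0 zero_le_one θ).const_mul _) fun n => hpoly (P n)

theorem integral_diameter_eq_neg_integral_semicircle {K : ℂ → ℂ} (hK : Differentiable ℂ K) :
    ∫ x in (-1 : ℝ)..1, K x
      = -∫ θ in (0 : ℝ)..π, K (circleMap 0 1 θ) * (circleMap 0 1 θ * I) := by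
  obtain ⟨Φ, hΦ⟩ := hK.isExactOn_univ
  have hdiameter : ∫ x in (-1 : ℝ)..1, K x = Φ (1 : ℝ) - Φ (-1 : ℝ) :=
    intervalIntegral.integral_eq_sub_of_hasDerivAt (f := fun x : ℝ => Φ x)
      (fun x _ => (hΦ x trivial).comp_ofReal)
      ((hK.continuous.comp continuous_ofReal).intervalIntegrable _ _)
  have hsemicircle : ∫ θ in (0 : ℝ)..π, K (circleMap 0 1 θ) * (circleMap 0 1 θ * I)
      = Φ (circleMap 0 1 π) - Φ (circleMap 0 1 0) :=
    intervalIntegral.integral_eq_sub_of_hasDerivAt (f := fun θ : ℝ => Φ (circleMap 0 1 θ))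
      (fun θ _ => (hΦ _ trivial).comp θ (hasDerivAt_circleMap 0 1 θ))
      (Continuous.intervalIntegrable (by have := hK.continuous; fun_prop) _ _)
  rw [hdiameter, hsemicircle]
  simp [circleMap]

theorem integral_comp_circleMap_add_comp_circleMap_neg {f : ℂ → ℝ} {r : ℝ}
    (hf : ContinuousOn f (sphere 0 |r|)) :
    ∫ θ in (0 : ℝ)..π, (f (circleMap 0 r θ) + f (circleMap 0 r (-θ)))
      = ∫ θ in (0 : ℝ)..(2 * π), f (circleMap 0 r θ) := by
  have hcont : Continuous fun θ => f (circleMap 0 r θ) :=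
    hf.comp_continuous (continuous_circleMap 0 r) (circleMap_mem_sphere' 0 r)
  have hcont_neg : Continuous fun θ => f (circleMap 0 r (-θ)) := hcont.comp continuous_neg
  have hperiod := ((periodic_circleMap 0 r).comp f).intervalIntegral_add_eq (-π) 0
  rw [show -π + 2 * π = π by ring, zero_add] at hperiod
  rw [intervalIntegral.integral_add (hcont.intervalIntegrable _ _)
    (hcont_neg.intervalIntegrable _ _),
    intervalIntegral.integral_comp_neg (fun θ => f (circleMap 0 r θ)), neg_zero, add_comm,
    intervalIntegral.integral_add_adjacent_intervals (hcont.intervalIntegrable _ _)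
      (hcont.intervalIntegrable _ _)]
  exact hperiod

theorem integral_norm_sq_diameter_le_of_differentiable {S : ℂ → ℂ} (hS : Differentiable ℂ S) :
    ∫ x in (-1 : ℝ)..1, ‖S x‖ ^ 2 ≤ 1 / 2 * ∫ θ in (0 : ℝ)..(2 * π), ‖S (circleMap 0 1 θ)‖ ^ 2 := by
  set K : ℂ → ℂ := fun z => S z * conj (S (conj z))
  have hK : Differentiable ℂ K := hS.mul fun z => differentiableAt_conj_conj_iff.2 (hS (conj z))
  have hcont := hS.continuous
  have hdiameter : ((∫ x in (-1 : ℝ)..1, ‖S x‖ ^ 2 : ℝ) : ℂ) = ∫ x in (-1 : ℝ)..1, K x := by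
    rw [← intervalIntegral.integral_ofReal]
    simp only [K, conj_ofReal, mul_conj, normSq_eq_norm_sq]
  calc ∫ x in (-1 : ℝ)..1, ‖S x‖ ^ 2
      ≤ ‖∫ x in (-1 : ℝ)..1, K x‖ := by
        rw [← hdiameter, norm_real]
        exact le_abs_self _
    _ ≤ ∫ θ in (0 : ℝ)..π, 1 / 2 * (‖S (circleMap 0 1 θ)‖ ^ 2 + ‖S (circleMap 0 1 (-θ))‖ ^ 2) := by
        rw [integral_diameter_eq_neg_integral_semicircle hK, norm_neg]
        refine intervalIntegral.norm_integral_le_of_norm_le Real.pi_pos.le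
          (ae_of_all _ fun θ _ => ?_) (Continuous.intervalIntegrable (by fun_prop) _ _)
        simp only [K, conj_circleMap_zero, norm_mul, norm_circleMap_zero, norm_I, abs_one, mul_one,
          RCLike.norm_conj]
        linarith [two_mul_le_add_sq ‖S (circleMap 0 1 θ)‖ ‖S (circleMap 0 1 (-θ))‖]
    _ = 1 / 2 * ∫ θ in (0 : ℝ)..(2 * π), ‖S (circleMap 0 1 θ)‖ ^ 2 := by
        rw [intervalIntegral.integral_const_mul, integral_comp_circleMap_add_comp_circleMap_neg
          (f := fun z => ‖S z‖ ^ 2) (by fun_prop)]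

theorem integral_norm_sq_diameter_le {S : ℂ → ℂ} (hS : DiffContOnCl ℂ S (ball 0 1)) :
    ∫ x in (-1 : ℝ)..1, ‖S x‖ ^ 2 ≤ 1 / 2 * ∫ θ in (0 : ℝ)..(2 * π), ‖S (circleMap 0 1 θ)‖ ^ 2 := by
  simpa only [Real.rpow_two] using fejerRiesz_of_forall_polynomial zero_le_two (fun P => by
    simpa only [Real.rpow_two] using integral_norm_sq_diameter_le_of_differentiable
      P.differentiable) hS

/-- `S` is holomorphic in the unit disk and continuous up to the circle, and `‖S‖ ^ 2` is a majorant
of `‖F‖ ^ p` that is exact on the circle. Replacing `F` by `S` reduces the Fejér–Riesz inequality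
for the exponent `p` to the exponent `2`. -/
structure IsHalfPowMajorant (p : ℝ) (F S : ℂ → ℂ) : Prop where
  diffContOnCl : DiffContOnCl ℂ S (ball 0 1)
  norm_rpow_le : ∀ z, ‖z‖ ≤ 1 → ‖F z‖ ^ p ≤ ‖S z‖ ^ 2
  norm_rpow_eq : ∀ z, ‖z‖ = 1 → ‖F z‖ ^ p = ‖S z‖ ^ 2

theorem norm_cpow_half_sq (z : ℂ) (p : ℝ) : ‖z ^ ((p / 2 : ℝ) : ℂ)‖ ^ 2 = ‖z‖ ^ p := by
  rw [norm_cpow_real, ← Real.rpow_mul_natCast (norm_nonneg z), Nat.cast_ofNat,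
    div_mul_cancel₀ p two_ne_zero]

namespace IsHalfPowMajorant

variable {p : ℝ} {F G S T : ℂ → ℂ}

theorem mul (hF : IsHalfPowMajorant p F S) (hG : IsHalfPowMajorant p G T) :
    IsHalfPowMajorant p (fun z => F z * G z) (fun z => S z * T z) where
  diffContOnCl := hF.diffContOnCl.smul hG.diffContOnCl
  norm_rpow_le z hz := by
    rw [norm_mul, norm_mul, mul_pow, Real.mul_rpow (norm_nonneg _) (norm_nonneg _)]
    exact mul_le_mul (hF.norm_rpow_le z hz) (hG.norm_rpow_le z hz) (by positivity) (by positivity)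
  norm_rpow_eq z hz := by
    rw [norm_mul, norm_mul, mul_pow, Real.mul_rpow (norm_nonneg _) (norm_nonneg _),
      hF.norm_rpow_eq z hz, hG.norm_rpow_eq z hz]

theorem const (p : ℝ) (c : ℂ) :
    IsHalfPowMajorant p (fun _ => c) fun _ => c ^ ((p / 2 : ℝ) : ℂ) where
  diffContOnCl := diffContOnCl_const
  norm_rpow_le _ _ := (norm_cpow_half_sq c p).ge
  norm_rpow_eq _ _ := (norm_cpow_half_sq c p).symm

theorem one_sub_mul (hp : 0 < p) {w : ℂ} (hw : ‖w‖ ≤ 1) :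
    IsHalfPowMajorant p (fun z => 1 - w * z) fun z => (1 - w * z) ^ ((p / 2 : ℝ) : ℂ) where
  diffContOnCl := by
    have hre {z : ℂ} : 1 - ‖z‖ ≤ (1 - w * z).re := by
      have := (re_le_norm (w * z)).trans_eq (norm_mul w z)
      rw [sub_re, one_re]
      linarith [mul_le_of_le_one_left (norm_nonneg z) hw]
    refine .mk_ball (fun z hz => ?_) fun z hz => ?_
    · rw [mem_ball_zero_iff] at hz
      exact (DifferentiableAt.cpow_const (by fun_prop)
        (Or.inl (by linarith [hre (z := z)]))).differentiableWithinAt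
    · rw [mem_closedBall_zero_iff] at hz
      have hcpow : ContinuousAt (fun x : ℂ => x ^ ((p / 2 : ℝ) : ℂ)) (1 - w * z) :=
        continuousAt_cpow_const_of_re_pos (Or.inl (by linarith [hre (z := z)]))
          (by rw [ofReal_re]; exact half_pos hp)
      exact (ContinuousAt.comp (f := fun z : ℂ => 1 - w * z) hcpow
        (by fun_prop)).continuousWithinAt
  norm_rpow_le z _ := (norm_cpow_half_sq _ p).ge
  norm_rpow_eq z _ := (norm_cpow_half_sq _ p).symm

theorem exists_sub (hp : 0 < p) (a : ℂ) : ∃ S, IsHalfPowMajorant p (fun z => z - a) S := by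
  rcases le_or_gt ‖a‖ 1 with ha | ha
  · have hS := one_sub_mul hp (w := conj a) (by simpa using ha)
    -- the Blaschke factor `(z - a) / (1 - conj a * z)` has norm `≤ 1`, with equality on `‖z‖ = 1`
    have hBlaschke (z : ℂ) :
        ‖1 - conj a * z‖ ^ 2 - ‖z - a‖ ^ 2 = (1 - ‖a‖ ^ 2) * (1 - ‖z‖ ^ 2) := by
      simp only [← normSq_eq_norm_sq, normSq_apply, sub_re, sub_im, mul_re, mul_im, conj_re,
        conj_im, one_re, one_im]
      ring
    refine ⟨_, hS.diffContOnCl, fun z hz => le_trans ?_ (hS.norm_rpow_le z hz), fun z hz => ?_⟩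
    · refine Real.rpow_le_rpow (norm_nonneg _) (le_of_sq_le_sq ?_ (norm_nonneg _)) hp.le
      have := mul_nonneg (sub_nonneg.2 (pow_le_one₀ (n := 2) (norm_nonneg a) ha))
        (sub_nonneg.2 (pow_le_one₀ (n := 2) (norm_nonneg z) hz))
      linarith [hBlaschke z]
    · rw [← hS.norm_rpow_eq z hz]
      congr 1
      refine (sq_eq_sq₀ (norm_nonneg _) (norm_nonneg _)).1 ?_
      have := hBlaschke z
      rw [hz] at this
      linarith
  · have ha0 : a ≠ 0 := norm_pos_iff.1 (by linarith)
    have hS := (const p (-a)).mul (one_sub_mul hp (w := a⁻¹)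
      (by rw [norm_inv]; exact inv_le_one_of_one_le₀ ha.le))
    have hfactor : (fun z => -a * (1 - a⁻¹ * z)) = fun z => z - a := by
      funext z
      field_simp
      ring
    exact ⟨_, hfactor ▸ hS⟩

theorem exists_polynomial (hp : 0 < p) (P : ℂ[X]) :
    ∃ S, IsHalfPowMajorant p (fun z => P.eval z) S := by
  have hprod (m : Multiset ℂ) : ∃ S, IsHalfPowMajorant p
      (fun z => ((m.map fun a => Polynomial.X - Polynomial.C a).prod).eval z) S := by
    induction m using Multiset.induction with
    | empty => exact ⟨_, by simpa using const p 1⟩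
    | cons a m ih =>
      obtain ⟨S, hS⟩ := ih
      obtain ⟨T, hT⟩ := exists_sub hp a
      exact ⟨_, by simpa using hT.mul hS⟩
  obtain ⟨S, hS⟩ := hprod P.roots
  have hP := (const p P.leadingCoeff).mul hS
  simp only [← Polynomial.eval_C_mul, ← (IsAlgClosed.splits P).eq_prod_roots] at hP
  exact ⟨_, hP⟩

theorem integral_norm_rpow_diameter_le (hF : ContinuousOn F (closedBall 0 1)) (hp : 0 ≤ p)
    (hS : IsHalfPowMajorant p F S) :
    ∫ x in (-1 : ℝ)..1, ‖F x‖ ^ p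
      ≤ 1 / 2 * ∫ θ in (0 : ℝ)..(2 * π), ‖F (circleMap 0 1 θ)‖ ^ p := by
  have hdiameter : Set.MapsTo ((↑) : ℝ → ℂ) (Set.uIcc (-1) 1) (closedBall 0 1) := fun x hx => by
    rw [Set.uIcc_of_le (by norm_num)] at hx
    simpa using abs_le.2 hx
  calc ∫ x in (-1 : ℝ)..1, ‖F x‖ ^ p
      ≤ ∫ x in (-1 : ℝ)..1, ‖S x‖ ^ 2 := by
        refine intervalIntegral.integral_mono_on (by norm_num) ?_ ?_ fun x hx =>
          hS.norm_rpow_le x (by simpa using abs_le.2 hx)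
        · exact ((hF.comp continuous_ofReal.continuousOn hdiameter).norm.rpow_const
            fun _ _ => Or.inr hp).intervalIntegrable
        · exact ((hS.diffContOnCl.continuousOn_ball.comp continuous_ofReal.continuousOn
            hdiameter).norm.pow 2).intervalIntegrable
    _ ≤ 1 / 2 * ∫ θ in (0 : ℝ)..(2 * π), ‖S (circleMap 0 1 θ)‖ ^ 2 :=
        integral_norm_sq_diameter_le hS.diffContOnCl
    _ = _ := by
        congr 2 with θ
        exact (hS.norm_rpow_eq _ (by simp)).symm

end IsHalfPowMajorant

theorem fejerRiesz_integral_norm_rpow_le {F : ℂ → ℂ} {p : ℝ} (hF : DiffContOnCl ℂ F (ball 0 1))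
    (hp : 0 < p) :
    ∫ x in (-1 : ℝ)..1, ‖F x‖ ^ p
      ≤ 1 / 2 * ∫ θ in (0 : ℝ)..(2 * π), ‖F (circleMap 0 1 θ)‖ ^ p := by
  refine fejerRiesz_of_forall_polynomial hp.le (fun P => ?_) hF
  obtain ⟨S, hS⟩ := IsHalfPowMajorant.exists_polynomial hp P
  exact hS.integral_norm_rpow_diameter_le P.continuousOn hp.le

end FejerRiesz

section PoissonKernel

open scoped Real

/-- The Poisson kernel `poissonKernel 0 (r * e^{iθ}) (e^{i(θ + s)})` of the unit disk, as a function
of the modulus `r` and of the angle `s` between the two points. -/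
def polarPoisson (r s : ℝ) : ℝ := (1 - r ^ 2) / (1 - 2 * r * Real.cos s + r ^ 2)

theorem norm_exp_mul_I_sub_ofReal_sq (r s : ℝ) :
    ‖Complex.exp (s * Complex.I) - r‖ ^ 2 = 1 - 2 * r * Real.cos s + r ^ 2 := by
  rw [← Complex.normSq_eq_norm_sq, Complex.normSq_apply]
  simp only [Complex.sub_re, Complex.sub_im, Complex.exp_ofReal_mul_I_re,
    Complex.exp_ofReal_mul_I_im, Complex.ofReal_re, Complex.ofReal_im]
  linear_combination Real.sin_sq_add_cos_sq s

theorem poissonKernel_circleMap_add (r θ s : ℝ) :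
    poissonKernel 0 (circleMap 0 r θ) (circleMap 0 1 (θ + s)) = polarPoisson r s := by
  have hfactor : circleMap 0 1 (θ + s) - circleMap 0 r θ
      = Complex.exp (θ * Complex.I) * (Complex.exp (s * Complex.I) - r) := by
    simp only [circleMap, Complex.ofReal_add, add_mul, Complex.exp_add, Complex.ofReal_one]
    ring
  rw [poissonKernel_def, sub_zero, sub_zero, hfactor, norm_mul, Complex.norm_exp_ofReal_mul_I,
    one_mul, norm_exp_mul_I_sub_ofReal_sq, norm_circleMap_zero, norm_circleMap_zero, sq_abs,
    sq_abs, one_pow, polarPoisson]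

theorem polarPoisson_denom_pos {r : ℝ} (h0 : 0 ≤ r) (h1 : r < 1) (s : ℝ) :
    0 < 1 - 2 * r * Real.cos s + r ^ 2 := by
  nlinarith [mul_le_of_le_one_right h0 (Real.cos_le_one s), sq_pos_of_pos (sub_pos.2 h1)]

theorem periodic_polarPoisson (r : ℝ) : Function.Periodic (polarPoisson r) (2 * π) := fun s => by
  simp [polarPoisson]

theorem contDiff_polarPoisson {r : ℝ} (h0 : 0 ≤ r) (h1 : r < 1) : ContDiff ℝ 1 (polarPoisson r) :=
  contDiff_const.div (by fun_prop) fun s => (polarPoisson_denom_pos h0 h1 s).ne'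

theorem deriv_polarPoisson {r : ℝ} (h0 : 0 ≤ r) (h1 : r < 1) (s : ℝ) :
    deriv (polarPoisson r) s =
      -((1 - r ^ 2) * (2 * r * Real.sin s) / (1 - 2 * r * Real.cos s + r ^ 2) ^ 2) := by
  have hdenom : HasDerivAt (fun s => 1 - 2 * r * Real.cos s + r ^ 2) (2 * r * Real.sin s) s := by
    simpa using (((Real.hasDerivAt_cos s).const_mul (2 * r)).const_sub 1).add_const (r ^ 2)
  have h := (hasDerivAt_const s (1 - r ^ 2)).div hdenom (polarPoisson_denom_pos h0 h1 s).ne'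
  rw [show polarPoisson r = (fun _ => 1 - r ^ 2) / fun s => 1 - 2 * r * Real.cos s + r ^ 2 from rfl,
    h.deriv]
  ring

theorem integral_polarPoisson {r : ℝ} (h0 : 0 ≤ r) (h1 : r < 1) :
    ∫ s in (-π)..π, polarPoisson r s = 2 * π := by
  have hmean := (diffContOnCl_const (𝕜 := ℂ) (c := (1 : ℂ))
    (s := Metric.ball (0 : ℂ) 1)).circleAverage_poissonKernel_smul (w := circleMap 0 r 0)
    (by simpa [circleMap, abs_of_nonneg h0] using h1)
  have hker (s : ℝ) : poissonKernel 0 (circleMap 0 r 0) (circleMap 0 1 s) = polarPoisson r s := by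
    simpa using poissonKernel_circleMap_add r 0 s
  simp only [Real.circleAverage_def, Pi.smul_apply', hker, Complex.real_smul, mul_one,
    intervalIntegral.integral_ofReal] at hmean
  have hperiod := (periodic_polarPoisson r).intervalIntegral_add_eq (-π) 0
  rw [show -π + 2 * π = π by ring, zero_add] at hperiod
  rw [hperiod]
  have hmean' : (2 * π)⁻¹ * ∫ s in (0 : ℝ)..(2 * π), polarPoisson r s = 1 := by
    exact_mod_cast hmean
  exact ((inv_mul_eq_one₀ Real.two_pi_pos.ne').1 hmean').symm

theorem tendsto_polarPoisson_pi : Tendsto (fun r => polarPoisson r π) (𝓝[<] 1) (𝓝 0) := by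
  have hcont : ContinuousAt (fun r => polarPoisson r π) 1 := by
    simp only [polarPoisson, Real.cos_pi]
    exact ContinuousAt.div (by fun_prop) (by fun_prop) (by norm_num)
  have hzero : polarPoisson 1 π = 0 := by simp [polarPoisson]
  exact hzero ▸ hcont.tendsto.mono_left nhdsWithin_le_nhds

theorem intervalIntegral_mul_eq_deriv_mul_primitive {u ψ : ℝ → ℝ} {a b c : ℝ}
    (hu : ContDiff ℝ 1 u) (hψ : IntervalIntegrable ψ volume a b) (hc : c ∈ Set.uIcc a b) :
    ∫ s in a..b, u s * ψ s = u b * (∫ x in c..b, ψ x) - u a * (∫ x in c..a, ψ x)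
      - ∫ s in a..b, deriv u s * ∫ x in c..s, ψ x := by
  rw [← hu.contDiffOn.absolutelyContinuousOnInterval.integral_mul_deriv_eq_deriv_mul
    (hψ.absolutelyContinuousOnInterval_intervalIntegral hc)]
  refine intervalIntegral.integral_congr_ae ?_
  filter_upwards [hψ.ae_hasDerivAt_integral] with s hs hmem
  rw [(hs (Set.uIoc_subset_uIcc hmem) c hc).deriv]

/-- The kernel `-s * P_r'(s) / (2π)`, where `P_r` is the Poisson kernel: after an integration by
parts the Poisson mean of `ψ` is the mean of the difference quotients of a primitive of `ψ` against
this kernel, which is an approximate identity. -/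
def fatouKernel (r s : ℝ) : ℝ := (2 * π)⁻¹ * -(s * deriv (polarPoisson r) s)

theorem continuous_fatouKernel {r : ℝ} (h0 : 0 ≤ r) (h1 : r < 1) : Continuous (fatouKernel r) := by
  have := (contDiff_polarPoisson h0 h1).continuous_deriv_one
  unfold fatouKernel
  fun_prop

theorem fatouKernel_nonneg {r s : ℝ} (h0 : 0 ≤ r) (h1 : r < 1) (hs : |s| ≤ π) :
    0 ≤ fatouKernel r s := by
  have hsin : 0 ≤ s * Real.sin s := by
    rcases le_total 0 s with h | h
    · exact mul_nonneg h (Real.sin_nonneg_of_nonneg_of_le_pi h (abs_le.1 hs).2)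
    · exact mul_nonneg_of_nonpos_of_nonpos h
        (Real.sin_nonpos_of_nonpos_of_neg_pi_le h (abs_le.1 hs).1)
  have hr : 0 ≤ 1 - r ^ 2 := sub_nonneg.2 (pow_le_one₀ h0 h1.le)
  rw [fatouKernel, deriv_polarPoisson h0 h1, show ∀ D : ℝ,
    -(s * -((1 - r ^ 2) * (2 * r * Real.sin s) / D ^ 2))
      = (1 - r ^ 2) * (2 * r) * (s * Real.sin s) / D ^ 2 from fun D => by ring]
  positivity

theorem sin_sq_le_polarPoisson_denom {r δ s : ℝ} (h0 : 0 ≤ r) (hδ : 0 ≤ δ) (hδs : δ ≤ |s|)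
    (hs : |s| ≤ π) : Real.sin δ ^ 2 ≤ 1 - 2 * r * Real.cos s + r ^ 2 := by
  have hcos : Real.cos s ≤ Real.cos δ := by
    rw [← Real.cos_abs s]
    exact Real.cos_le_cos_of_nonneg_of_le_pi hδ hs hδs
  nlinarith [Real.sin_sq_add_cos_sq δ, sq_nonneg (r - Real.cos δ),
    mul_le_mul_of_nonneg_left hcos h0]

theorem fatouKernel_le {r δ s : ℝ} (h0 : 0 ≤ r) (h1 : r < 1) (hδ : 0 < δ) (hδπ : δ < π)
    (hδs : δ ≤ |s|) (hs : |s| ≤ π) : fatouKernel r s ≤ (1 - r ^ 2) / Real.sin δ ^ 4 := by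
  have hsin : 0 < Real.sin δ := Real.sin_pos_of_pos_of_lt_pi hδ hδπ
  have hr : 0 ≤ 1 - r ^ 2 := sub_nonneg.2 (pow_le_one₀ h0 h1.le)
  have hnum : r * (s * Real.sin s) ≤ π := calc
    r * (s * Real.sin s) ≤ 1 * (π * 1) := by
      refine mul_le_mul_of_nonneg h1.le ((le_abs_self _).trans ?_) h0 (by positivity)
      rw [abs_mul]
      exact mul_le_mul hs (Real.abs_sin_le_one s) (abs_nonneg _) Real.pi_pos.le
    _ = π := by ring
  calc fatouKernel r s
      = (1 - r ^ 2) * (r * (s * Real.sin s) / π) / (1 - 2 * r * Real.cos s + r ^ 2) ^ 2 := by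
        rw [fatouKernel, deriv_polarPoisson h0 h1]
        ring
    _ ≤ (1 - r ^ 2) * 1 / (Real.sin δ ^ 2) ^ 2 := by
        gcongr
        · exact (div_le_one₀ Real.pi_pos).2 hnum
        · exact sin_sq_le_polarPoisson_denom h0 hδ.le hδs hs
    _ = (1 - r ^ 2) / Real.sin δ ^ 4 := by rw [mul_one, ← pow_mul]

theorem tendstoUniformlyOn_fatouKernel {u : Set ℝ} (hu : IsOpen u) (h0u : (0 : ℝ) ∈ u) :
    TendstoUniformlyOn fatouKernel 0 (𝓝[<] 1) (Set.Ioc (-π) π \ u) := by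
  obtain ⟨η, hη, hηu⟩ := Metric.isOpen_iff.1 hu 0 h0u
  obtain ⟨δ, hδ, hδmin⟩ := exists_between (lt_min hη Real.pi_pos)
  obtain ⟨hδη, hδπ⟩ := lt_min_iff.1 hδmin
  have hbound : Tendsto (fun r : ℝ => (1 - r ^ 2) / Real.sin δ ^ 4) (𝓝[<] 1) (𝓝 0) := by
    have hcont : Continuous fun r : ℝ => (1 - r ^ 2) / Real.sin δ ^ 4 := by fun_prop
    simpa using (hcont.tendsto 1).mono_left nhdsWithin_le_nhds
  refine Metric.tendstoUniformlyOn_iff.2 fun ε hε => ?_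
  filter_upwards [hbound.eventually_lt_const hε, Ioo_mem_nhdsLT (zero_lt_one' ℝ)]
    with r hr hr01 s hs
  have hsπ : |s| ≤ π := abs_le.2 ⟨hs.1.1.le, hs.1.2⟩
  have hδs : δ ≤ |s| := by
    by_contra! h
    exact hs.2 (hηu (by simpa using h.trans hδη))
  rw [Pi.zero_apply, dist_zero_left, Real.norm_of_nonneg (fatouKernel_nonneg hr01.1.le hr01.2 hsπ)]
  exact (fatouKernel_le hr01.1.le hr01.2 hδ hδπ hδs hsπ).trans_lt hr

theorem integral_polarPoisson_mul {ψ : ℝ → ℝ} (hψ : IntervalIntegrable ψ volume (-π) π) {r : ℝ}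
    (h0 : 0 ≤ r) (h1 : r < 1) :
    (2 * π)⁻¹ * ∫ s in (-π)..π, polarPoisson r s * ψ s
      = (2 * π)⁻¹ * polarPoisson r π * (∫ x in (-π)..π, ψ x)
        + ∫ s in (-π)..π, fatouKernel r s * dslope (fun s => ∫ x in (0 : ℝ)..s, ψ x) 0 s := by
  have hmem : (0 : ℝ) ∈ Set.uIcc (-π) π := by
    rw [Set.uIcc_of_le (by linarith [Real.pi_pos])]
    exact ⟨by linarith [Real.pi_pos], Real.pi_pos.le⟩
  have hneg : polarPoisson r (-π) = polarPoisson r π := by simp [polarPoisson]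
  have hsplit := intervalIntegral.integral_interval_sub_left (hψ.mono_set
    (Set.uIcc_subset_uIcc_right hmem)) (hψ.mono_set (Set.uIcc_subset_uIcc_left hmem)).symm
  have hdslope (s : ℝ) : fatouKernel r s * dslope (fun s => ∫ x in (0 : ℝ)..s, ψ x) 0 s
      = (2 * π)⁻¹ * -(deriv (polarPoisson r) s * ∫ x in (0 : ℝ)..s, ψ x) := by
    have := sub_smul_dslope (fun s => ∫ x in (0 : ℝ)..s, ψ x) 0 s
    rw [intervalIntegral.integral_same, sub_zero, sub_zero, smul_eq_mul] at this
    rw [fatouKernel, ← this]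
    ring
  simp only [hdslope]
  rw [intervalIntegral.integral_const_mul, intervalIntegral.integral_neg,
    intervalIntegral_mul_eq_deriv_mul_primitive (contDiff_polarPoisson h0 h1) hψ hmem, hneg,
    ← hsplit]
  ring

theorem tendsto_integral_fatouKernel :
    Tendsto (fun r => ∫ s in (-π)..π, fatouKernel r s) (𝓝[<] 1) (𝓝 1) := by
  have hone (s : ℝ) : dslope (fun s => ∫ _ in (0 : ℝ)..s, (1 : ℝ)) 0 s = 1 := by
    rcases eq_or_ne s 0 with rfl | hs
    · simp
    · simp [dslope_of_ne _ hs, slope_def_field, hs]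
  have hlim : Tendsto (fun r => 1 - polarPoisson r π) (𝓝[<] 1) (𝓝 1) := by
    simpa using tendsto_polarPoisson_pi.const_sub 1
  refine hlim.congr' ?_
  filter_upwards [Ioo_mem_nhdsLT (zero_lt_one' ℝ)] with r hr
  have h := integral_polarPoisson_mul (ψ := fun _ => 1) (by simp) hr.1.le hr.2
  simp only [hone, mul_one, integral_polarPoisson hr.1.le hr.2] at h
  rw [inv_mul_cancel₀ Real.two_pi_pos.ne', intervalIntegral.integral_const, smul_eq_mul] at h
  rw [h]
  field_simp
  ring

theorem tendsto_integral_polarPoisson_mul {ψ : ℝ → ℝ}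
    (hψ : IntervalIntegrable ψ volume (-π) π) {c : ℝ}
    (hc : HasDerivAt (fun s => ∫ x in (0 : ℝ)..s, ψ x) c 0) :
    Tendsto (fun r => (2 * π)⁻¹ * ∫ s in (-π)..π, polarPoisson r s * ψ s) (𝓝[<] 1) (𝓝 c) := by
  have hle : -π ≤ π := by linarith [Real.pi_pos]
  have hmem : Set.Icc (-π) π ∈ 𝓝 (0 : ℝ) := Icc_mem_nhds (by linarith [Real.pi_pos]) Real.pi_pos
  have hcont : ContinuousOn (dslope (fun s => ∫ x in (0 : ℝ)..s, ψ x) 0) (Set.Icc (-π) π) := by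
    refine (continuousOn_dslope hmem).2 ⟨?_, hc.differentiableAt⟩
    rw [← Set.uIcc_of_le hle] at hmem ⊢
    exact intervalIntegral.continuousOn_primitive_interval' hψ (mem_of_mem_nhds hmem)
  have hpeak := tendsto_setIntegral_peak_smul_of_integrableOn_of_tendsto (μ := volume)
    (s := Set.Ioc (-π) π) (t := Set.Ioc (-π) π) (x₀ := (0 : ℝ)) (l := 𝓝[<] (1 : ℝ))
    (φ := fatouKernel) (g := dslope (fun s => ∫ x in (0 : ℝ)..s, ψ x) 0) (a := c)
    measurableSet_Ioc measurableSet_Ioc subset_rfl self_mem_nhdsWithin (by simp)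
    (by filter_upwards [Ioo_mem_nhdsLT (zero_lt_one' ℝ)] with r hr s hs using
      fatouKernel_nonneg hr.1.le hr.2 (abs_le.2 ⟨hs.1.le, hs.2⟩))
    (fun _ => tendstoUniformlyOn_fatouKernel)
    (by simpa only [intervalIntegral.integral_of_le hle] using tendsto_integral_fatouKernel)
    (by filter_upwards [Ioo_mem_nhdsLT (zero_lt_one' ℝ)] with r hr using
      (continuous_fatouKernel hr.1.le hr.2).aestronglyMeasurable)
    (hcont.integrableOn_Icc.mono_set Set.Ioc_subset_Icc_self)
    (by
      have := (hcont.continuousAt hmem).tendsto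
      rw [dslope_same, hc.deriv] at this
      exact this.mono_left nhdsWithin_le_nhds)
  simp only [smul_eq_mul, ← intervalIntegral.integral_of_le hle] at hpeak
  have hboundary : Tendsto (fun r => (2 * π)⁻¹ * polarPoisson r π * ∫ x in (-π)..π, ψ x)
      (𝓝[<] 1) (𝓝 0) := by
    simpa using (tendsto_polarPoisson_pi.const_mul (2 * π)⁻¹).mul_const (∫ x in (-π)..π, ψ x)
  refine (zero_add c ▸ hboundary.add hpeak).congr' ?_
  filter_upwards [Ioo_mem_nhdsLT (zero_lt_one' ℝ)] with r hr
  exact (integral_polarPoisson_mul hψ hr.1.le hr.2).symm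

end PoissonKernel

section HarmonicDiameter

open Complex Metric Real
open scoped ComplexConjugate

variable {h g : ℂ → ℂ} {ρ : ℝ}

theorem integral_norm_rpow_diameter_le_circleAverage {F : ℂ → ℂ} {p : ℝ}
    (hF : DiffContOnCl ℂ F (ball 0 ρ)) (hρ : 0 < ρ) (hp : 0 < p) (t : ℝ) :
    ∫ x in (-ρ)..ρ, ‖F (x * exp (t * I))‖ ^ p
      ≤ π * ρ * circleAverage (fun z => ‖F z‖ ^ p) 0 ρ := by
  have hscale : DiffContOnCl ℂ (fun z => F (circleMap 0 ρ t * z)) (ball 0 1) := by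
    refine hF.comp (Differentiable.diffContOnCl (by fun_prop)) fun z hz => ?_
    rw [mem_ball_zero_iff] at hz ⊢
    rw [norm_mul, norm_circleMap_zero, abs_of_pos hρ]
    exact mul_lt_of_lt_one_right hρ hz
  have hrotate (θ : ℝ) : circleMap 0 ρ t * circleMap 0 1 θ = circleMap 0 ρ (θ + t) := by
    rw [circleMap_zero_mul, mul_one, add_comm]
  have hdiameter : ∫ x in (-ρ)..ρ, ‖F (x * exp (t * I))‖ ^ p
      = ρ * ∫ x in (-1 : ℝ)..1, ‖F (circleMap 0 ρ t * x)‖ ^ p := by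
    have := intervalIntegral.mul_integral_comp_mul_left (a := -1) (b := 1)
      (f := fun x : ℝ => ‖F (x * exp (t * I))‖ ^ p) (c := ρ)
    rw [mul_neg, mul_one] at this
    rw [← this]
    congr 2 with x
    rw [circleMap_zero, ofReal_mul, mul_right_comm]
  have hfr := fejerRiesz_integral_norm_rpow_le hscale hp
  simp only [hrotate] at hfr
  rw [hdiameter, circleAverage_eq_integral_add t, smul_eq_mul]
  calc _ ≤ ρ * (1 / 2 * ∫ θ in (0 : ℝ)..2 * π, ‖F (circleMap 0 ρ (θ + t))‖ ^ p) := by gcongr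
    _ = _ := by field_simp

theorem norm_add_conj_sq (a b : ℂ) :
    ‖a + conj b‖ ^ 2 = ‖a‖ ^ 2 + ‖b‖ ^ 2 + 2 * (a * b).re := by
  simp only [← normSq_eq_norm_sq, normSq_apply, add_re, add_im, conj_re, conj_im, mul_re]
  ring

theorem norm_add_conj_sq_le (a b : ℂ) : ‖a + conj b‖ ^ 2 ≤ ‖a‖ ^ 2 + ‖b‖ ^ 2 + 2 * ‖a * b‖ := by
  rw [norm_add_conj_sq]
  gcongr
  exact re_le_norm _

theorem circleIntegrable_norm_sq {c : ℂ} (hh : ContinuousOn h (sphere c |ρ|)) :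
    CircleIntegrable (fun z => ‖h z‖ ^ 2) c ρ :=
  (hh.norm.pow 2).circleIntegrable'

theorem circleAverage_norm_sq_add_norm_sq {c : ℂ} (hh : ContinuousOn h (sphere c |ρ|))
    (hg : ContinuousOn g (sphere c |ρ|)) :
    circleAverage (fun z => ‖h z‖ ^ 2 + ‖g z‖ ^ 2) c ρ
      = circleAverage (fun z => ‖h z‖ ^ 2) c ρ + circleAverage (fun z => ‖g z‖ ^ 2) c ρ :=
  circleAverage_fun_add (circleIntegrable_norm_sq hh) (circleIntegrable_norm_sq hg)

theorem circleAverage_norm_add_conj_sq {c : ℂ} (hh : DiffContOnCl ℂ h (ball c |ρ|))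
    (hg : DiffContOnCl ℂ g (ball c |ρ|)) (hg0 : g c = 0) (hρ : ρ ≠ 0) :
    circleAverage (fun z => ‖h z + conj (g z)‖ ^ 2) c ρ
      = circleAverage (fun z => ‖h z‖ ^ 2) c ρ + circleAverage (fun z => ‖g z‖ ^ 2) c ρ := by
  have hsphere : sphere c |ρ| ⊆ closure (ball c |ρ|) := by
    rw [closure_ball c (abs_ne_zero.2 hρ)]
    exact sphere_subset_closedBall
  have hhc := hh.continuousOn.mono hsphere
  have hgc := hg.continuousOn.mono hsphere
  have hmul : CircleIntegrable (fun z => h z * g z) c ρ := (hhc.mul hgc).circleIntegrable'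
  have hzero : circleAverage (fun z => (h z * g z).re) c ρ = 0 := by
    have hmean := (hh.smul hg).circleAverage
    simp only [smul_eq_mul, hg0, mul_zero] at hmean
    have := reCLM.circleAverage_comp_comm hmul
    rwa [hmean, map_zero] at this
  have hsq : CircleIntegrable (fun z => ‖h z‖ ^ 2 + ‖g z‖ ^ 2) c ρ :=
    (circleIntegrable_norm_sq hhc).add (circleIntegrable_norm_sq hgc)
  have hre : CircleIntegrable (fun z => (2 : ℝ) • (h z * g z).re) c ρ :=
    ((continuous_re.comp_continuousOn (hhc.mul hgc)).const_smul (2 : ℝ)).circleIntegrable'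
  simp only [norm_add_conj_sq, ← smul_eq_mul (2 : ℝ)]
  rw [circleAverage_fun_add hsq hre, circleAverage_norm_sq_add_norm_sq hhc hgc,
    circleAverage_fun_smul, hzero, smul_zero, add_zero]

theorem two_mul_circleAverage_norm_mul_le {c : ℂ} (hh : ContinuousOn h (sphere c |ρ|))
    (hg : ContinuousOn g (sphere c |ρ|)) :
    2 * circleAverage (fun z => ‖h z * g z‖) c ρ
      ≤ circleAverage (fun z => ‖h z‖ ^ 2) c ρ + circleAverage (fun z => ‖g z‖ ^ 2) c ρ := by
  have hmul : CircleIntegrable (fun z => (2 : ℝ) • ‖h z * g z‖) c ρ :=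
    ((hh.mul hg).norm.const_smul (2 : ℝ)).circleIntegrable'
  rw [← circleAverage_norm_sq_add_norm_sq hh hg, ← smul_eq_mul, ← circleAverage_fun_smul]
  refine circleAverage_mono hmul
    ((circleIntegrable_norm_sq hh).add (circleIntegrable_norm_sq hg)) fun z _ => ?_
  rw [norm_mul, smul_eq_mul, ← mul_assoc]
  exact two_mul_le_add_sq _ _

theorem integral_norm_add_conj_sq_le {u v : ℝ → ℂ} {a b : ℝ} (hab : a ≤ b)
    (hu : ContinuousOn u (Set.uIcc a b)) (hv : ContinuousOn v (Set.uIcc a b)) :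
    ∫ x in a..b, ‖u x + conj (v x)‖ ^ 2
      ≤ (∫ x in a..b, ‖u x‖ ^ 2) + (∫ x in a..b, ‖v x‖ ^ 2) + 2 * ∫ x in a..b, ‖u x * v x‖ := by
  have iu : IntervalIntegrable (fun x => ‖u x‖ ^ 2) volume a b := (hu.norm.pow 2).intervalIntegrable
  have iv : IntervalIntegrable (fun x => ‖v x‖ ^ 2) volume a b := (hv.norm.pow 2).intervalIntegrable
  have iuv : IntervalIntegrable (fun x => 2 * ‖u x * v x‖) volume a b :=
    ((hu.mul hv).norm.const_mul 2).intervalIntegrable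
  rw [← intervalIntegral.integral_add iu iv, ← intervalIntegral.integral_const_mul,
    ← intervalIntegral.integral_add (iu.add iv) iuv]
  refine intervalIntegral.integral_mono_on hab ?_ ((iu.add iv).add iuv) fun x _ =>
    norm_add_conj_sq_le _ _
  exact ((hu.add (continuous_conj.comp_continuousOn hv)).norm.pow 2).intervalIntegrable

theorem integral_norm_add_conj_sq_diameter_le (hh : DiffContOnCl ℂ h (ball 0 ρ))
    (hg : DiffContOnCl ℂ g (ball 0 ρ)) (hg0 : g 0 = 0) (hρ : 0 < ρ) (t : ℝ) :
    ∫ x in (-ρ)..ρ, ‖h (x * exp (t * I)) + conj (g (x * exp (t * I)))‖ ^ 2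
      ≤ π * ρ * (circleAverage (fun z => ‖h z + conj (g z)‖ ^ 2) 0 ρ
        + 2 * circleAverage (fun z => ‖h z * g z‖) 0 ρ) := by
  have hmaps : Set.MapsTo (fun x : ℝ => (x : ℂ) * exp (t * I)) (Set.uIcc (-ρ) ρ)
      (closedBall 0 ρ) := fun x hx => by
    rw [Set.uIcc_of_le (by linarith)] at hx
    simpa using abs_le.2 hx
  have hsq {F : ℂ → ℂ} (hF : DiffContOnCl ℂ F (ball 0 ρ)) :
      ∫ x in (-ρ)..ρ, ‖F (x * exp (t * I))‖ ^ 2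
        ≤ π * ρ * circleAverage (fun z => ‖F z‖ ^ 2) 0 ρ := by
    simpa only [rpow_two] using integral_norm_rpow_diameter_le_circleAverage hF hρ two_pos t
  have hprod : ∫ x in (-ρ)..ρ, ‖h (x * exp (t * I)) * g (x * exp (t * I))‖
      ≤ π * ρ * circleAverage (fun z => ‖h z * g z‖) 0 ρ := by
    simpa only [rpow_one, smul_eq_mul] using
      integral_norm_rpow_diameter_le_circleAverage (hh.smul hg) hρ one_pos t
  calc _ ≤ (∫ x in (-ρ)..ρ, ‖h (x * exp (t * I))‖ ^ 2) + (∫ x in (-ρ)..ρ, ‖g (x * exp (t * I))‖ ^ 2)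
        + 2 * ∫ x in (-ρ)..ρ, ‖h (x * exp (t * I)) * g (x * exp (t * I))‖ :=
        integral_norm_add_conj_sq_le (by linarith)
          (hh.continuousOn_ball.comp (by fun_prop) hmaps)
          (hg.continuousOn_ball.comp (by fun_prop) hmaps)
    _ ≤ π * ρ * (circleAverage (fun z => ‖h z‖ ^ 2) 0 ρ + circleAverage (fun z => ‖g z‖ ^ 2) 0 ρ
        + 2 * circleAverage (fun z => ‖h z * g z‖) 0 ρ) := by linarith [hsq hh, hsq hg]
    _ = _ := by
        rw [← abs_of_pos hρ] at hh hg
        rw [circleAverage_norm_add_conj_sq hh hg hg0 hρ.ne']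

end HarmonicDiameter

section Fatou

open scoped Real

theorem intervalIntegrable_of_locallyIntegrable {E : Type*} [NormedAddCommGroup E] {ψ : ℝ → E}
    (hψ : LocallyIntegrable ψ) (a b : ℝ) : IntervalIntegrable ψ volume a b :=
  intervalIntegrable_iff.2
    ((hψ.integrableOn_isCompact isCompact_uIcc).mono_set Set.uIoc_subset_uIcc)

theorem intervalIntegrable_comp_add_left {E : Type*} [NormedAddCommGroup E] {ψ : ℝ → E}
    (hψ : LocallyIntegrable ψ) (θ a b : ℝ) :
    IntervalIntegrable (fun s => ψ (θ + s)) volume a b := by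
  simpa using (intervalIntegrable_of_locallyIntegrable hψ (θ + a) (θ + b)).comp_add_left (c := θ)
    enorm_ne_top

theorem ae_hasDerivAt_integral_add_left {ψ : ℝ → ℝ} (hψ : LocallyIntegrable ψ) :
    ∀ᵐ θ : ℝ, HasDerivAt (fun s => ∫ x in (0 : ℝ)..s, ψ (θ + x)) (ψ θ) 0 := by
  filter_upwards [LocallyIntegrable.ae_hasDerivAt_integral hψ] with θ hθ
  have hprim (s : ℝ) : ∫ x in (0 : ℝ)..s, ψ (θ + x) = ∫ x in θ..(θ + s), ψ x := by
    simp
  simp only [hprim]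
  exact HasDerivAt.comp_const_add θ (0 : ℝ) (by simpa using hθ θ)

theorem ae_tendsto_integral_polarPoisson_mul {ψ : ℝ → ℝ} (hψ : LocallyIntegrable ψ) :
    ∀ᵐ θ : ℝ, Tendsto (fun r => (2 * π)⁻¹ * ∫ s in (-π)..π, polarPoisson r s * ψ (θ + s))
      (𝓝[<] 1) (𝓝 (ψ θ)) := by
  filter_upwards [ae_hasDerivAt_integral_add_left hψ] with θ hθ
  exact tendsto_integral_polarPoisson_mul (intervalIntegrable_comp_add_left hψ θ _ _) hθ

theorem ae_tendsto_integral_polarPoisson_smul {ψ : ℝ → ℂ} (hψ : LocallyIntegrable ψ) :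
    ∀ᵐ θ : ℝ, Tendsto (fun r => (2 * π)⁻¹ • ∫ s in (-π)..π, polarPoisson r s • ψ (θ + s))
      (𝓝[<] 1) (𝓝 (ψ θ)) := by
  have hcomp (L : ℂ →L[ℝ] ℝ) : ∀ᵐ θ : ℝ,
      Tendsto (fun r => L ((2 * π)⁻¹ • ∫ s in (-π)..π, polarPoisson r s • ψ (θ + s)))
        (𝓝[<] 1) (𝓝 (L (ψ θ))) := by
    have hL : LocallyIntegrable fun x => L (ψ x) := fun x =>
      (hψ x).imp fun _ hs => ⟨hs.1, L.integrable_comp hs.2⟩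
    filter_upwards [ae_tendsto_integral_polarPoisson_mul hL] with θ hθ
    refine hθ.congr' ?_
    filter_upwards [Ioo_mem_nhdsLT (zero_lt_one' ℝ)] with r hr
    rw [L.map_smul, ← L.intervalIntegral_comp_comm
      ((intervalIntegrable_comp_add_left hψ θ _ _).continuousOn_smul
        (contDiff_polarPoisson hr.1.le hr.2).continuous.continuousOn)]
    simp only [map_smul, smul_eq_mul]
  filter_upwards [hcomp Complex.reCLM, hcomp Complex.imCLM] with θ hre him
  exact (Complex.equivRealProdCLM.symm.continuous.tendsto (_, _)).comp (hre.prodMk_nhds him)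

end Fatou

section AbelMeans

theorem norm_mul_pow_sub_le (a : ℂ) {r : ℝ} (h0 : 0 ≤ r) (h1 : r ≤ 1) (n : ℕ) :
    ‖a * (r : ℂ) ^ n - a‖ ≤ ‖a‖ := by
  have hpow : ‖(r : ℂ) ^ n - 1‖ ≤ 1 := by
    rw [← Complex.ofReal_pow, ← Complex.ofReal_one, ← Complex.ofReal_sub, Complex.norm_real,
      Real.norm_eq_abs, abs_le]
    constructor <;> linarith [pow_le_one₀ h0 h1 (n := n), pow_nonneg h0 n]
  calc ‖a * (r : ℂ) ^ n - a‖ = ‖a‖ * ‖(r : ℂ) ^ n - 1‖ := by rw [← norm_mul, mul_sub_one]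
    _ ≤ ‖a‖ := mul_le_of_le_one_right (norm_nonneg _) hpow

theorem tendsto_mul_pow (a : ℂ) (n : ℕ) :
    Tendsto (fun r : ℝ => a * (r : ℂ) ^ n) (𝓝[<] 1) (𝓝 a) := by
  have hcont : Continuous fun r : ℝ => a * (r : ℂ) ^ n := by fun_prop
  simpa using (hcont.tendsto 1).mono_left nhdsWithin_le_nhds

theorem summable_norm_sq_of_abel {a : ℕ → ℂ} {S : ℝ → ℝ} {M : ℝ}
    (hS : ∀ r ∈ Set.Ioo (0 : ℝ) 1, HasSum (fun n => ‖a n * (r : ℂ) ^ n‖ ^ 2) (S r))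
    (hM : ∀ r ∈ Set.Ioo (0 : ℝ) 1, S r ≤ M) : Summable fun n => ‖a n‖ ^ 2 := by
  refine summable_of_sum_le (fun n => by positivity) (c := M) fun s => ?_
  refine le_of_tendsto (tendsto_finsetSum s fun n _ => ((tendsto_mul_pow (a n) n).norm.pow 2)) ?_
  filter_upwards [Ioo_mem_nhdsLT (zero_lt_one' ℝ)] with r hr
  exact (sum_le_hasSum s (fun n _ => by positivity) (hS r hr)).trans (hM r hr)

theorem tendsto_tsum_norm_mul_pow_sub_sq {a : ℕ → ℂ} (ha : Summable fun n => ‖a n‖ ^ 2) :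
    Tendsto (fun r : ℝ => ∑' n, ‖a n * (r : ℂ) ^ n - a n‖ ^ 2) (𝓝[<] 1) (𝓝 0) := by
  rw [← tsum_zero (β := ℕ)]
  refine tendsto_tsum_of_dominated_convergence ha (fun n => ?_) ?_
  · simpa using ((tendsto_mul_pow (a n) n).sub_const (a n)).norm.pow 2
  · filter_upwards [Ioo_mem_nhdsLT (zero_lt_one' ℝ)] with r hr n
    rw [norm_pow, norm_norm]
    gcongr
    exact norm_mul_pow_sub_le (a n) hr.1.le hr.2.le n

variable {ι E : Type*} [NormedAddCommGroup E] [InnerProductSpace ℂ E]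

theorem hasSum_norm_sq_of_orthonormal {v : ι → E} (hv : Orthonormal ℂ v) {c : ι → ℂ} {x : E}
    (hx : HasSum (fun i => c i • v i) x) : HasSum (fun i => ‖c i‖ ^ 2) (‖x‖ ^ 2) := by
  have hfinite (s : Finset ι) : ‖∑ i ∈ s, c i • v i‖ ^ 2 = ∑ i ∈ s, ‖c i‖ ^ 2 := by
    simpa using hv.orthogonalFamily.norm_sum c s
  exact (Tendsto.pow (Tendsto.norm hx) 2).congr hfinite

theorem exists_tendsto_abel_of_orthonormal [CompleteSpace E] {v : ℕ → E} (hv : Orthonormal ℂ v)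
    {a : ℕ → ℂ} {U : ℝ → E} {M : ℝ}
    (hU : ∀ r ∈ Set.Ioo (0 : ℝ) 1, HasSum (fun n => (a n * (r : ℂ) ^ n) • v n) (U r))
    (hM : ∀ r ∈ Set.Ioo (0 : ℝ) 1, ‖U r‖ ^ 2 ≤ M) : ∃ φ, Tendsto U (𝓝[<] 1) (𝓝 φ) := by
  have ha : Summable fun n => ‖a n‖ ^ 2 :=
    summable_norm_sq_of_abel (fun r hr => hasSum_norm_sq_of_orthonormal hv (hU r hr)) hM
  have hφ : Summable fun n => a n • v n := by
    simpa using (hv.orthogonalFamily.summable_iff_norm_sq_summable a).2 ha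
  have hdist (r : ℝ) (hr : r ∈ Set.Ioo (0 : ℝ) 1) :
      ‖U r - ∑' n, a n • v n‖ ^ 2 = ∑' n, ‖a n * (r : ℂ) ^ n - a n‖ ^ 2 := by
    have h := (hU r hr).sub hφ.hasSum
    simp only [← sub_smul] at h
    exact (hasSum_norm_sq_of_orthonormal hv h).tsum_eq.symm
  have hsq : Tendsto (fun r => ‖U r - ∑' n, a n • v n‖ ^ 2) (𝓝[<] 1) (𝓝 0) := by
    refine (tendsto_tsum_norm_mul_pow_sub_sq ha).congr' ?_
    filter_upwards [Ioo_mem_nhdsLT (zero_lt_one' ℝ)] with r hr using (hdist r hr).symm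
  refine ⟨∑' n, a n • v n, tendsto_iff_norm_sub_tendsto_zero.2 ?_⟩
  simpa using hsq.sqrt.congr fun r => Real.sqrt_sq (norm_nonneg _)

end AbelMeans

section CircleL2

open AddCircle Metric Real
open scoped ComplexConjugate

/-- The period of the angle is positive, as the measure theory of `AddCircle (2 * π)` requires. -/
instance fact_two_pi_pos : Fact (0 < 2 * π) := ⟨two_pi_pos⟩

/-- The space `L²` of the unit circle, parametrized by the angle. -/
abbrev CircleL2 : Type := Lp ℂ 2 (haarAddCircle : Measure (AddCircle (2 * π)))

theorem coe_toCircle_two_pi (θ : ℝ) :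
    ((toCircle (θ : AddCircle (2 * π)) : Circle) : ℂ) = Complex.exp (θ * Complex.I) := by
  rw [toCircle_apply_mk, div_self two_pi_pos.ne', one_mul, Circle.coe_exp]

theorem norm_mul_toCircle_lt_one {r : ℝ} (hr : r ∈ Set.Ioo (0 : ℝ) 1)
    (θ : AddCircle (2 * π)) : ‖(r : ℂ) * (toCircle θ : ℂ)‖ < 1 := by
  rw [norm_mul, Circle.norm_coe, mul_one, Complex.norm_real, norm_of_nonneg hr.1.le]
  exact hr.2

theorem continuous_coe_toCircle {T : ℝ} : Continuous fun θ : AddCircle T => (toCircle θ : ℂ) :=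
  continuous_subtype_val.comp continuous_toCircle

theorem locallyIntegrable_comp_coe {T : ℝ} [hT : Fact (0 < T)] {E : Type*} [NormedAddCommGroup E]
    {G : AddCircle T → E} (hG : Integrable G haarAddCircle) :
    LocallyIntegrable fun x : ℝ => G x := by
  have hvol : Integrable G volume := by
    rw [volume_eq_smul_haarAddCircle]
    exact hG.smul_measure ENNReal.ofReal_ne_top
  have hperiod : Function.Periodic (fun x : ℝ => G x) T := fun x => by simp
  have hint (a b : ℝ) : IntervalIntegrable (fun x : ℝ => G x) volume a b := by
    refine hperiod.intervalIntegrable (t := 0) hT.out.ne' ?_ a b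
    rw [intervalIntegrable_iff_integrableOn_Ioc_of_le (by linarith [hT.out])]
    exact (AddCircle.measurePreserving_mk T 0).integrable_comp_of_integrable hvol
  refine locallyIntegrable_iff.2 fun k hk => ?_
  obtain ⟨R, hR⟩ := hk.isBounded.subset_closedBall 0
  refine IntegrableOn.mono_set ?_ hR
  rw [Real.closedBall_eq_Icc, integrableOn_Icc_iff_integrableOn_Ioc]
  exact (hint _ _).1

variable {E : Type*} [NormedAddCommGroup E] [NormedSpace ℝ E]

theorem integral_haarAddCircle_eq_intervalIntegral (G : AddCircle (2 * π) → E) (t : ℝ) :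
    ∫ θ, G θ ∂haarAddCircle
      = (2 * π)⁻¹ • ∫ θ in t..(t + 2 * π), G (θ : AddCircle (2 * π)) := by
  rw [integral_haarAddCircle, AddCircle.intervalIntegral_preimage]

theorem integral_haarAddCircle_eq_circleAverage (G : ℂ → E) (r : ℝ) :
    ∫ θ : AddCircle (2 * π), G (r * (toCircle θ : ℂ)) ∂haarAddCircle = circleAverage G 0 r := by
  rw [integral_haarAddCircle_eq_intervalIntegral _ 0, zero_add, circleAverage_def]
  simp only [coe_toCircle_two_pi, circleMap_zero]

variable {α : Type*} [MeasurableSpace α] {μ : Measure α}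

theorem norm_sq_Lp_two_eq_integral (u : Lp ℂ 2 μ) : ‖u‖ ^ 2 = ∫ x, ‖u x‖ ^ 2 ∂μ := by
  have h := congrArg RCLike.re (L2.inner_def (𝕜 := ℂ) u u)
  rw [← integral_re (L2.integrable_inner u u)] at h
  simpa only [← norm_sq_eq_re_inner] using h

theorem continuous_integral_norm_mul :
    Continuous fun p : Lp ℂ 2 μ × Lp ℂ 2 μ => ∫ x, ‖p.1 x * p.2 x‖ ∂μ := by
  have hnorm : Continuous fun p : Lp ℂ 2 μ × Lp ℂ 2 μ =>
      ‖(ContinuousLinearMap.mul ℂ ℂ).holderL μ 2 2 1 p.1 p.2‖ := by fun_prop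
  refine hnorm.congr fun p => ?_
  rw [L1.norm_eq_integral_norm, ContinuousLinearMap.holderL_apply_apply]
  refine integral_congr_ae ?_
  filter_upwards [(ContinuousLinearMap.mul ℂ ℂ).coeFn_holder (r := 1) p.1 p.2] with x hx
  rw [hx, ContinuousLinearMap.mul_apply']

theorem continuous_integral_norm_add_conj_sq :
    Continuous fun p : Lp ℂ 2 μ × Lp ℂ 2 μ => ∫ x, ‖p.1 x + conj (p.2 x)‖ ^ 2 ∂μ := by
  set conjL := (Complex.conjCLE : ℂ →L[ℝ] ℂ)
  have hnorm : Continuous fun p : Lp ℂ 2 μ × Lp ℂ 2 μ => ‖p.1 + conjL.compLpL 2 μ p.2‖ ^ 2 := by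
    fun_prop
  refine hnorm.congr fun p => ?_
  rw [norm_sq_Lp_two_eq_integral]
  refine integral_congr_ae ?_
  filter_upwards [Lp.coeFn_add p.1 (conjL.compLpL 2 μ p.2), conjL.coeFn_compLpL p.2] with x hx hx'
  rw [hx, Pi.add_apply, hx']
  simp [conjL]

theorem continuous_integral_smul {K : α → ℝ} (hK : MemLp K 2 μ) :
    Continuous fun u : Lp ℂ 2 μ => ∫ x, K x • u x ∂μ := by
  have hpair : Continuous fun u : Lp ℂ 2 μ =>
      (ContinuousLinearMap.lsmul ℝ ℝ).lpPairing μ 2 2 hK.toLp u := by fun_prop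
  refine hpair.congr fun u => ?_
  rw [ContinuousLinearMap.lpPairing_eq_integral]
  refine integral_congr_ae ?_
  filter_upwards [hK.coeFn_toLp] with x hx
  rw [hx, ContinuousLinearMap.lsmul_apply]

end CircleL2

section Dilation

open AddCircle Metric Real

variable {F : ℂ → ℂ} {r : ℝ}

open Classical in
/-- The dilation `e^{iθ} ↦ F (r * e^{iθ})` as an element of `L²` of the unit circle. The value is
the junk `0` if the dilation is discontinuous; only `0 < r < 1` and `F` continuous in the open unit
disk matter. -/
def dilationLp (F : ℂ → ℂ) (r : ℝ) : CircleL2 :=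
  if hc : Continuous fun θ : AddCircle (2 * π) => F (r * (toCircle θ : ℂ))
  then ContinuousMap.toLp 2 haarAddCircle ℂ ⟨_, hc⟩ else 0

theorem continuous_dilation (hF : ContinuousOn F (ball 0 1)) (hr : r ∈ Set.Ioo (0 : ℝ) 1) :
    Continuous fun θ : AddCircle (2 * π) => F (r * (toCircle θ : ℂ)) :=
  hF.comp_continuous (continuous_const.mul continuous_coe_toCircle)
    fun θ => by simpa using norm_mul_toCircle_lt_one hr θ

theorem coeFn_dilationLp (hF : ContinuousOn F (ball 0 1)) (hr : r ∈ Set.Ioo (0 : ℝ) 1) :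
    dilationLp F r =ᵐ[haarAddCircle] fun θ => F (r * (toCircle θ : ℂ)) := by
  rw [dilationLp, dif_pos (continuous_dilation hF hr)]
  exact ContinuousMap.coeFn_toLp _ _

theorem norm_sq_dilationLp (hF : ContinuousOn F (ball 0 1)) (hr : r ∈ Set.Ioo (0 : ℝ) 1) :
    ‖dilationLp F r‖ ^ 2 = circleAverage (fun z => ‖F z‖ ^ 2) 0 r := by
  rw [norm_sq_Lp_two_eq_integral, ← integral_haarAddCircle_eq_circleAverage]
  exact integral_congr_ae ((coeFn_dilationLp hF hr).fun_comp fun z => ‖z‖ ^ 2)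

theorem hasSum_taylorCoeff_mul_pow {R : ℝ} (hF : DifferentiableOn ℂ F (ball 0 R)) {z : ℂ}
    (hz : z ∈ ball (0 : ℂ) R) :
    HasSum (fun n : ℕ => (n.factorial : ℂ)⁻¹ * iteratedDeriv n F 0 * z ^ n) (F z) := by
  refine (Complex.hasSum_taylorSeries_on_ball hF hz).congr_fun fun n => ?_
  rw [sub_zero, smul_eq_mul, smul_eq_mul]
  ring

theorem hasSum_dilationLp (hF : DifferentiableOn ℂ F (ball 0 1)) (hr : r ∈ Set.Ioo (0 : ℝ) 1) :
    HasSum (fun n : ℕ => ((n.factorial : ℂ)⁻¹ * iteratedDeriv n F 0 * (r : ℂ) ^ n) •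
      fourierLp (T := 2 * π) 2 (n : ℤ)) (dilationLp F r) := by
  set a : ℕ → ℂ := fun n => (n.factorial : ℂ)⁻¹ * iteratedDeriv n F 0
  have hsummable : Summable fun n : ℕ => (a n * (r : ℂ) ^ n) • fourier (T := 2 * π) (n : ℤ) := by
    refine Summable.of_norm ?_
    simp only [norm_smul, fourier_norm, mul_one]
    exact (hasSum_taylorCoeff_mul_pow hF (z := r)
      (by simpa [abs_of_pos hr.1] using hr.2)).summable.norm
  have hdilation : (⟨_, continuous_dilation hF.continuousOn hr⟩ : C(AddCircle (2 * π), ℂ))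
      = ∑' n : ℕ, (a n * (r : ℂ) ^ n) • fourier (T := 2 * π) (n : ℤ) := by
    ext θ
    refine HasSum.unique ?_ ((ContinuousMap.evalCLM ℂ θ).hasSum hsummable.hasSum)
    rw [ContinuousMap.coe_mk]
    convert hasSum_taylorCoeff_mul_pow hF (z := r * (toCircle θ : ℂ))
      (by simpa using norm_mul_toCircle_lt_one hr θ) using 2 with n
    simp [a, fourier_apply, toCircle_nsmul, mul_pow, mul_assoc]
  have hLp := (ContinuousMap.toLp (E := ℂ) 2 (haarAddCircle (T := 2 * π)) ℂ).hasSum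
    hsummable.hasSum
  rw [dilationLp, dif_pos (continuous_dilation hF.continuousOn hr), hdilation]
  simpa only [map_smul] using hLp

theorem exists_tendsto_dilationLp (hF : DifferentiableOn ℂ F (ball 0 1)) {M : ℝ}
    (hM : ∀ r ∈ Set.Ioo (0 : ℝ) 1, circleAverage (fun z => ‖F z‖ ^ 2) 0 r ≤ M) :
    ∃ φ, Tendsto (dilationLp F) (𝓝[<] 1) (𝓝 φ) :=
  exists_tendsto_abel_of_orthonormal
    (orthonormal_fourier.comp (fun n : ℕ => (n : ℤ)) Nat.cast_injective)
    (fun _ hr => hasSum_dilationLp hF hr)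
    fun r hr => (norm_sq_dilationLp hF.continuousOn hr).trans_le (hM r hr)

end Dilation

section PoissonRepresentation

open AddCircle Metric Real

variable {F : ℂ → ℂ} {w : ℂ} {φ : CircleL2}

theorem continuous_poissonKernel_toCircle (hw : w ∈ ball (0 : ℂ) 1) :
    Continuous fun θ : AddCircle (2 * π) => poissonKernel 0 w (toCircle θ) := by
  have := continuous_coe_toCircle (T := 2 * π)
  have hne (θ : AddCircle (2 * π)) : (toCircle θ : ℂ) - w ≠ 0 := fun h => by
    rw [← sub_eq_zero.1 h, mem_ball_zero_iff, Circle.norm_coe] at hw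
    exact hw.false
  simp only [poissonKernel_def, sub_zero]
  exact Continuous.div (by fun_prop) (by fun_prop) fun θ => by simpa using hne θ

theorem integral_poissonKernel_smul_dilationLp (hF : DifferentiableOn ℂ F (ball 0 1))
    (hw : w ∈ ball (0 : ℂ) 1) {r : ℝ} (hr : r ∈ Set.Ioo (0 : ℝ) 1) :
    ∫ θ, poissonKernel 0 w (toCircle θ) • dilationLp F r θ ∂haarAddCircle = F (r * w) := by
  have hdiff : DiffContOnCl ℂ (fun z => F (r * z)) (ball 0 1) := by
    refine DifferentiableOn.diffContOnCl ?_
    rw [closure_ball (0 : ℂ) one_ne_zero]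
    refine hF.comp (by fun_prop) fun z hz => ?_
    rw [mem_closedBall_zero_iff] at hz
    rw [mem_ball_zero_iff, norm_mul, Complex.norm_real, norm_of_nonneg hr.1.le]
    nlinarith [hr.1, hr.2, norm_nonneg z]
  rw [← hdiff.circleAverage_poissonKernel_smul hw, ← integral_haarAddCircle_eq_circleAverage]
  refine integral_congr_ae ?_
  filter_upwards [coeFn_dilationLp hF.continuousOn hr] with θ hθ
  rw [hθ, Complex.ofReal_one, one_mul, Pi.smul_apply']

theorem integral_poissonKernel_smul (hF : DifferentiableOn ℂ F (ball 0 1))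
    (hφ : Tendsto (dilationLp F) (𝓝[<] 1) (𝓝 φ)) (hw : w ∈ ball (0 : ℂ) 1) :
    ∫ θ, poissonKernel 0 w (toCircle θ) • φ θ ∂haarAddCircle = F w := by
  have hkernel : MemLp (fun θ : AddCircle (2 * π) => poissonKernel 0 w (toCircle θ)) 2
      haarAddCircle :=
    (continuous_poissonKernel_toCircle hw).memLp_of_hasCompactSupport
      (HasCompactSupport.of_compactSpace _)
  have hintegral := ((continuous_integral_smul hkernel).tendsto φ).comp hφ
  have hvalue : Tendsto (fun r : ℝ => F (r * w)) (𝓝[<] 1) (𝓝 (F w)) := by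
    have hcont : ContinuousAt F w :=
      hF.continuousOn.continuousAt (isOpen_ball.mem_nhds hw)
    have hmul : Continuous fun r : ℝ => (r : ℂ) * w := by fun_prop
    refine hcont.tendsto.comp ?_
    simpa using (hmul.tendsto 1).mono_left nhdsWithin_le_nhds
  refine tendsto_nhds_unique hintegral (hvalue.congr' ?_)
  filter_upwards [Ioo_mem_nhdsLT (zero_lt_one' ℝ)] with r hr
  exact (integral_poissonKernel_smul_dilationLp hF hw hr).symm

theorem inv_two_pi_smul_integral_polarPoisson_smul (hF : DifferentiableOn ℂ F (ball 0 1))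
    (hφ : Tendsto (dilationLp F) (𝓝[<] 1) (𝓝 φ)) {r : ℝ} (hr : r ∈ Set.Ioo (0 : ℝ) 1) (θ : ℝ) :
    (2 * π)⁻¹ • ∫ s in (-π)..π, polarPoisson r s • φ ((θ + s : ℝ) : AddCircle (2 * π))
      = F (circleMap 0 r θ) := by
  have hw : circleMap 0 r θ ∈ ball (0 : ℂ) 1 := by
    simpa [abs_of_pos hr.1] using hr.2
  rw [← integral_poissonKernel_smul hF hφ hw,
    integral_haarAddCircle_eq_intervalIntegral _ (θ + -π), show θ + -π + 2 * π = θ + π by ring,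
    ← intervalIntegral.integral_comp_add_left]
  congr 2 with s
  rw [coe_toCircle_two_pi, ← poissonKernel_circleMap_add r θ s, circleMap_zero 1,
    Complex.ofReal_one, one_mul]

theorem ae_hasRadialLimit (hF : DifferentiableOn ℂ F (ball 0 1))
    (hφ : Tendsto (dilationLp F) (𝓝[<] 1) (𝓝 φ)) :
    ∀ᵐ θ : ℝ, HasRadialLimit F θ (φ (θ : AddCircle (2 * π))) := by
  have hint : Integrable φ haarAddCircle := (Lp.memLp φ).integrable (by norm_num)
  filter_upwards [ae_tendsto_integral_polarPoisson_smul (locallyIntegrable_comp_coe hint)]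
    with θ hθ
  refine hθ.congr' ?_
  filter_upwards [Ioo_mem_nhdsLT (zero_lt_one' ℝ)] with r hr
  rw [inv_two_pi_smul_integral_polarPoisson_smul hF hφ hr, circleMap_zero]

end PoissonRepresentation

section HardySpace

open AddCircle Metric Real
open scoped ComplexConjugate

variable {f h g : ℂ → ℂ} {φ γ : CircleL2} {r : ℝ}

theorem integralMean_two_sq (r : ℝ) (f : ℂ → ℂ) :
    integralMean 2 r f ^ 2 = circleAverage (fun z => ‖f z‖ ^ 2) 0 r := by
  have hnonneg : 0 ≤ circleAverage (fun z => ‖f z‖ ^ 2) 0 r :=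
    circleAverage_nonneg_of_nonneg fun z _ => by positivity
  rw [← rpow_inv_natCast_pow hnonneg two_ne_zero, integralMean, circleAverage_def]
  simp only [circleMap_zero, smul_eq_mul, one_div, rpow_two, Nat.cast_ofNat]

theorem HasRadialLimit.boundaryValue_eq {F : ℂ → ℂ} {θ : ℝ} {w : ℂ}
    (hF : HasRadialLimit F θ w) : boundaryValue F θ = w :=
  Tendsto.limUnder_eq hF

/-- `φ` is the boundary function of `F`: the dilations of `F` converge to `φ` in `L²` of the unit
circle, and `φ` gives the radial limits of `F` almost everywhere. -/
structure HasL2BoundaryFunction (F : ℂ → ℂ) (φ : CircleL2) : Prop where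
  continuousOn : ContinuousOn F (ball 0 1)
  tendsto_dilationLp : Tendsto (dilationLp F) (𝓝[<] 1) (𝓝 φ)
  ae_hasRadialLimit : ∀ᵐ θ : ℝ, HasRadialLimit F θ (φ (θ : AddCircle (2 * π)))

theorem exists_hasL2BoundaryFunction {F : ℂ → ℂ} (hF : DifferentiableOn ℂ F (ball 0 1)) {M : ℝ}
    (hM : ∀ r ∈ Set.Ioo (0 : ℝ) 1, circleAverage (fun z => ‖F z‖ ^ 2) 0 r ≤ M) :
    ∃ φ, HasL2BoundaryFunction F φ :=
  let ⟨φ, hφ⟩ := exists_tendsto_dilationLp hF hM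
  ⟨φ, hF.continuousOn, hφ, ae_hasRadialLimit hF hφ⟩

theorem HasL2BoundaryFunction.tendsto_circleAverage {N : ℂ → ℂ → ℝ} {B : ℝ → ℝ}
    (hh : HasL2BoundaryFunction h φ) (hg : HasL2BoundaryFunction g γ)
    (hN : Continuous fun p : CircleL2 × CircleL2 => ∫ θ, N (p.1 θ) (p.2 θ) ∂haarAddCircle)
    (hB : ∀ᵐ θ : ℝ, B θ = N (φ θ) (γ θ)) :
    Tendsto (circleAverage (fun z => N (h z) (g z)) 0) (𝓝[<] 1)
      (𝓝 ((2 * π)⁻¹ * ∫ θ in (0 : ℝ)..(2 * π), B θ)) := by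
  have hlimit : ∫ θ, N (φ θ) (γ θ) ∂haarAddCircle
      = (2 * π)⁻¹ * ∫ θ in (0 : ℝ)..(2 * π), B θ := by
    rw [integral_haarAddCircle_eq_intervalIntegral _ 0, zero_add, smul_eq_mul,
      intervalIntegral.integral_congr_ae (hB.mono fun θ hθ _ => hθ)]
  rw [← hlimit]
  refine ((hN.tendsto (φ, γ)).comp
    (hh.tendsto_dilationLp.prodMk_nhds hg.tendsto_dilationLp)).congr' ?_
  filter_upwards [Ioo_mem_nhdsLT (zero_lt_one' ℝ)] with r hr
  rw [← integral_haarAddCircle_eq_circleAverage]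
  refine integral_congr_ae ?_
  filter_upwards [coeFn_dilationLp hh.continuousOn hr, coeFn_dilationLp hg.continuousOn hr]
    with θ hhθ hgθ
  rw [hhθ, hgθ]

namespace IsCanonicalDecomposition

theorem circleAverage_norm_sq (hd : IsCanonicalDecomposition f h g)
    (hr : r ∈ Set.Ioo (0 : ℝ) 1) :
    circleAverage (fun z => ‖f z‖ ^ 2) 0 r
      = circleAverage (fun z => ‖h z + conj (g z)‖ ^ 2) 0 r :=
  circleAverage_congr_sphere fun z hz => by
    have hz' : z ∈ ball (0 : ℂ) 1 :=
      sphere_subset_ball (by rw [abs_of_pos hr.1]; exact hr.2) hz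
    simp only [hd.eq_on_disk z hz']

theorem diffContOnCl_ball (hd : IsCanonicalDecomposition f h g) (hr : r ∈ Set.Ioo (0 : ℝ) 1) :
    DiffContOnCl ℂ h (ball 0 r) ∧ DiffContOnCl ℂ g (ball 0 r) :=
  ⟨hd.analytic_h.diffContOnCl_ball (closedBall_subset_ball hr.2),
    hd.analytic_g.diffContOnCl_ball (closedBall_subset_ball hr.2)⟩

theorem circleAverage_norm_sq_eq_add (hd : IsCanonicalDecomposition f h g)
    (hr : r ∈ Set.Ioo (0 : ℝ) 1) :
    circleAverage (fun z => ‖f z‖ ^ 2) 0 r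
      = circleAverage (fun z => ‖h z‖ ^ 2) 0 r + circleAverage (fun z => ‖g z‖ ^ 2) 0 r := by
  obtain ⟨hh, hg⟩ := hd.diffContOnCl_ball hr
  rw [← abs_of_pos hr.1] at hh hg
  rw [hd.circleAverage_norm_sq hr, circleAverage_norm_add_conj_sq hh hg hd.normalized hr.1.ne']

theorem exists_hasL2BoundaryFunction (hd : IsCanonicalDecomposition f h g)
    (hf : MemHarmonicHardy 2 f) :
    ∃ φ γ, HasL2BoundaryFunction h φ ∧ HasL2BoundaryFunction g γ := by
  obtain ⟨M, hM⟩ := hf.bounded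
  have hsum (r : ℝ) (hr : r ∈ Set.Ioo (0 : ℝ) 1) :
      circleAverage (fun z => ‖h z‖ ^ 2) 0 r + circleAverage (fun z => ‖g z‖ ^ 2) 0 r
        ≤ M ^ 2 := by
    rw [← hd.circleAverage_norm_sq_eq_add hr, ← integralMean_two_sq]
    exact pow_le_pow_left₀ (rpow_nonneg (mul_nonneg (by positivity)
      (intervalIntegral.integral_nonneg two_pi_pos.le fun θ _ => by positivity)) _)
      (hM r hr.1.le hr.2) 2
  have hnonneg (F : ℂ → ℂ) (r : ℝ) : 0 ≤ circleAverage (fun z => ‖F z‖ ^ 2) 0 r :=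
    circleAverage_nonneg_of_nonneg fun z _ => by positivity
  obtain ⟨φ, hφ⟩ := _root_.exists_hasL2BoundaryFunction hd.analytic_h
    fun r hr => (le_add_of_nonneg_right (hnonneg g r)).trans (hsum r hr)
  obtain ⟨γ, hγ⟩ := _root_.exists_hasL2BoundaryFunction hd.analytic_g
    fun r hr => (le_add_of_nonneg_left (hnonneg h r)).trans (hsum r hr)
  exact ⟨φ, γ, hφ, hγ⟩

theorem ae_hasRadialLimit (hd : IsCanonicalDecomposition f h g)
    (hφ : HasL2BoundaryFunction h φ) (hγ : HasL2BoundaryFunction g γ) :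
    ∀ᵐ θ : ℝ, HasRadialLimit f θ (φ θ + conj (γ θ)) := by
  filter_upwards [hφ.ae_hasRadialLimit, hγ.ae_hasRadialLimit] with θ hhθ hgθ
  refine (Tendsto.add hhθ ((Complex.continuous_conj.tendsto _).comp hgθ)).congr' ?_
  filter_upwards [Ioo_mem_nhdsLT (zero_lt_one' ℝ)] with r hr
  exact (hd.eq_on_disk _ (by simpa [abs_of_pos hr.1] using hr.2)).symm

theorem ae_norm_sq_boundaryValue (hd : IsCanonicalDecomposition f h g)
    (hφ : HasL2BoundaryFunction h φ) (hγ : HasL2BoundaryFunction g γ) :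
    ∀ᵐ θ : ℝ, ‖boundaryValue f θ‖ ^ 2 = ‖φ θ + conj (γ θ)‖ ^ 2 := by
  filter_upwards [hd.ae_hasRadialLimit hφ hγ] with θ hθ
  rw [hθ.boundaryValue_eq]

theorem intervalIntegrable_norm_sq_boundaryValue (hd : IsCanonicalDecomposition f h g)
    (hφ : HasL2BoundaryFunction h φ) (hγ : HasL2BoundaryFunction g γ) (a b : ℝ) :
    IntervalIntegrable (fun θ => ‖boundaryValue f θ‖ ^ 2) volume a b := by
  have hLp : MemLp (fun θ => φ θ + conj (γ θ)) 2 haarAddCircle :=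
    (Lp.memLp φ).add (Lp.memLp γ).star
  refine (intervalIntegrable_of_locallyIntegrable (locallyIntegrable_comp_coe
    (hLp.integrable_norm_pow two_ne_zero)) a b).congr_ae (ae_restrict_of_ae ?_)
  exact (hd.ae_norm_sq_boundaryValue hφ hγ).mono fun θ hθ => hθ.symm

theorem tendsto_circleAverage_norm_sq (hd : IsCanonicalDecomposition f h g)
    (hφ : HasL2BoundaryFunction h φ) (hγ : HasL2BoundaryFunction g γ) :
    Tendsto (circleAverage (fun z => ‖f z‖ ^ 2) 0) (𝓝[<] 1)
      (𝓝 ((2 * π)⁻¹ * boundarySqIntegral f)) := by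
  refine (hφ.tendsto_circleAverage (N := fun a b => ‖a + conj b‖ ^ 2) hγ
    continuous_integral_norm_add_conj_sq (hd.ae_norm_sq_boundaryValue hφ hγ)).congr' ?_
  filter_upwards [Ioo_mem_nhdsLT (zero_lt_one' ℝ)] with r hr
  exact (hd.circleAverage_norm_sq hr).symm

end IsCanonicalDecomposition

namespace HasL2BoundaryFunction

theorem ae_hasRadialLimit_mul (hφ : HasL2BoundaryFunction h φ) (hγ : HasL2BoundaryFunction g γ) :
    ∀ᵐ θ : ℝ, HasRadialLimit (fun z => h z * g z) θ (φ θ * γ θ) := by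
  filter_upwards [hφ.ae_hasRadialLimit, hγ.ae_hasRadialLimit] with θ hhθ hgθ
  exact Tendsto.mul hhθ hgθ

theorem ae_norm_boundaryValue_mul (hφ : HasL2BoundaryFunction h φ)
    (hγ : HasL2BoundaryFunction g γ) :
    ∀ᵐ θ : ℝ, ‖boundaryValue (fun z => h z * g z) θ‖ = ‖φ θ * γ θ‖ := by
  filter_upwards [hφ.ae_hasRadialLimit_mul hγ] with θ hθ
  rw [hθ.boundaryValue_eq]

theorem intervalIntegrable_norm_boundaryValue_mul (hφ : HasL2BoundaryFunction h φ)
    (hγ : HasL2BoundaryFunction g γ) (a b : ℝ) :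
    IntervalIntegrable (fun θ => ‖boundaryValue (fun z => h z * g z) θ‖) volume a b := by
  refine (intervalIntegrable_of_locallyIntegrable (locallyIntegrable_comp_coe
    ((Lp.memLp φ).integrable_mul (Lp.memLp γ)).norm) a b).congr_ae (ae_restrict_of_ae ?_)
  exact (hφ.ae_norm_boundaryValue_mul hγ).mono fun θ hθ => hθ.symm

theorem tendsto_circleAverage_norm_mul (hφ : HasL2BoundaryFunction h φ)
    (hγ : HasL2BoundaryFunction g γ) :
    Tendsto (circleAverage (fun z => ‖h z * g z‖) 0) (𝓝[<] 1)
      (𝓝 ((2 * π)⁻¹ * prodL1Norm h g)) :=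
  hφ.tendsto_circleAverage (N := fun a b => ‖a * b‖) hγ continuous_integral_norm_mul
    (hφ.ae_norm_boundaryValue_mul hγ)

end HasL2BoundaryFunction

theorem intervalIntegrable_and_integral_le_of_tendsto {F B : ℝ → ℝ} {b : ℝ} (hF : ∀ x, 0 ≤ F x)
    (hint : ∀ ρ ∈ Set.Ioo (0 : ℝ) 1, IntervalIntegrable F volume (-ρ) ρ)
    (hle : ∀ ρ ∈ Set.Ioo (0 : ℝ) 1, ∫ x in (-ρ)..ρ, F x ≤ B ρ) (hB : Tendsto B (𝓝[<] 1) (𝓝 b)) :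
    IntervalIntegrable F volume (-1) 1 ∧ ∫ x in (-1 : ℝ)..1, F x ≤ b := by
  obtain ⟨u, -, hu, hulim⟩ := exists_seq_strictMono_tendsto' (zero_lt_one' ℝ)
  have hBu : Tendsto (B ∘ u) atTop (𝓝 b) := hB.comp
    (tendsto_nhdsWithin_iff.2 ⟨hulim, Eventually.of_forall fun n => (hu n).2⟩)
  have hneg_le (n : ℕ) : -u n ≤ u n := by linarith [(hu n).1]
  have hbound (n : ℕ) : ∫ x in Set.Ioc (-u n) (u n), F x ≤ B (u n) := by
    rw [← intervalIntegral.integral_of_le (hneg_le n)]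
    exact hle _ (hu n)
  obtain ⟨M, hM⟩ := hBu.bddAbove_range
  have hF' : IntegrableOn F (Set.Ioc (-1) 1) := by
    refine integrableOn_Ioc_of_intervalIntegral_norm_bounded (I := M) (fun n => (hint _ (hu n)).1)
      hulim.neg hulim (Eventually.of_forall fun n => ?_)
    simp only [norm_of_nonneg (hF _)]
    exact (hbound n).trans (hM ⟨n, rfl⟩)
  refine ⟨(intervalIntegrable_iff_integrableOn_Ioc_of_le (by norm_num)).2 hF', ?_⟩
  rw [intervalIntegral.integral_of_le (by norm_num)]
  refine le_of_tendsto_of_tendsto' ((aecover_Ioc_of_Ioc (μ := volume) hulim.neg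
    hulim).integral_tendsto_of_countably_generated hF') hBu fun n => ?_
  rw [Measure.restrict_restrict measurableSet_Ioc, Set.inter_eq_left.2
    (Set.Ioc_subset_Ioc (neg_le_neg (hu n).2.le) (hu n).2.le)]
  exact hbound n

theorem half_boundarySqIntegral_add_prodL1Norm_le (hd : IsCanonicalDecomposition f h g)
    (hφ : HasL2BoundaryFunction h φ) (hγ : HasL2BoundaryFunction g γ) :
    1 / 2 * boundarySqIntegral f + prodL1Norm h g ≤ boundarySqIntegral f := by
  have hlim : 2 * ((2 * π)⁻¹ * prodL1Norm h g) ≤ (2 * π)⁻¹ * boundarySqIntegral f := by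
    refine le_of_tendsto_of_tendsto ((hφ.tendsto_circleAverage_norm_mul hγ).const_mul 2)
      (hd.tendsto_circleAverage_norm_sq hφ hγ) ?_
    filter_upwards [Ioo_mem_nhdsLT (zero_lt_one' ℝ)] with r hr
    rw [hd.circleAverage_norm_sq_eq_add hr]
    have hsphere : sphere (0 : ℂ) |r| ⊆ ball 0 1 :=
      sphere_subset_ball (by rw [abs_of_pos hr.1]; exact hr.2)
    exact two_mul_circleAverage_norm_mul_le (hφ.continuousOn.mono hsphere)
      (hγ.continuousOn.mono hsphere)
  rw [mul_left_comm, mul_le_mul_iff_right₀ (by positivity)] at hlim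
  linarith

theorem intervalIntegrable_and_diameterIntegral_le (hd : IsCanonicalDecomposition f h g)
    (hφ : HasL2BoundaryFunction h φ) (hγ : HasL2BoundaryFunction g γ) (t : ℝ) :
    IntervalIntegrable (fun x : ℝ => ‖f (x * Complex.exp (t * Complex.I))‖ ^ 2) volume (-1) 1 ∧
      diameterIntegral f t ≤ 1 / 2 * boundarySqIntegral f + prodL1Norm h g := by
  have hball {ρ : ℝ} (hρ : ρ ∈ Set.Ioo (0 : ℝ) 1) {x : ℝ} (hx : x ∈ Set.uIcc (-ρ) ρ) :
      (x : ℂ) * Complex.exp (t * Complex.I) ∈ ball (0 : ℂ) 1 := by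
    rw [Set.uIcc_of_le (by linarith [hρ.1])] at hx
    simpa using (abs_le.2 hx).trans_lt hρ.2
  have hcont : ContinuousOn f (ball 0 1) :=
    (hd.analytic_h.continuousOn.add
      (Complex.continuous_conj.comp_continuousOn hd.analytic_g.continuousOn)).congr hd.eq_on_disk
  refine intervalIntegrable_and_integral_le_of_tendsto (fun x => by positivity)
    (B := fun ρ => π * ρ * (circleAverage (fun z => ‖f z‖ ^ 2) 0 ρ
      + 2 * circleAverage (fun z => ‖h z * g z‖) 0 ρ)) (fun ρ hρ => ?_) (fun ρ hρ => ?_) ?_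
  · exact ((hcont.comp (by fun_prop) fun x hx => hball hρ hx).norm.pow 2).intervalIntegrable
  · obtain ⟨hh, hg⟩ := hd.diffContOnCl_ball hρ
    rw [hd.circleAverage_norm_sq hρ, intervalIntegral.integral_congr fun x hx => by
      rw [hd.eq_on_disk _ (hball hρ hx)]]
    exact integral_norm_add_conj_sq_diameter_le hh hg hd.normalized hρ.1 t
  · have hid : Tendsto (fun ρ : ℝ => ρ) (𝓝[<] 1) (𝓝 1) := nhdsWithin_le_nhds
    convert (hid.const_mul π).mul ((hd.tendsto_circleAverage_norm_sq hφ hγ).add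
      ((hφ.tendsto_circleAverage_norm_mul hγ).const_mul 2)) using 2
    field_simp

end HardySpace

section ContinuousBoundary

open Metric Real
open scoped ComplexConjugate

variable {f h g : ℂ → ℂ}

theorem boundaryValue_eq_of_continuousOn {F : ℂ → ℂ} (hF : ContinuousOn F (closedBall 0 1))
    (θ : ℝ) : boundaryValue F θ = F (circleMap 0 1 θ) := by
  refine HasRadialLimit.boundaryValue_eq ((hF (circleMap 0 1 θ) (by simp)).tendsto.comp
    (tendsto_nhdsWithin_iff.2 ⟨?_, ?_⟩))
  · have hray : Continuous fun r : ℝ => (r : ℂ) * Complex.exp (θ * Complex.I) := by fun_prop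
    simpa [circleMap] using (hray.tendsto 1).mono_left nhdsWithin_le_nhds
  · filter_upwards [Ioo_mem_nhdsLT (zero_lt_one' ℝ)] with r hr
    simpa [abs_of_pos hr.1] using hr.2.le

theorem boundarySqIntegral_eq_circleAverage (hf : ContinuousOn f (closedBall 0 1)) :
    boundarySqIntegral f = 2 * π * circleAverage (fun z => ‖f z‖ ^ 2) 0 1 := by
  simp only [boundarySqIntegral, boundaryValue_eq_of_continuousOn hf, circleAverage_def,
    smul_eq_mul, mul_inv_cancel_left₀ two_pi_pos.ne']

theorem prodL1Norm_eq_circleAverage (hh : ContinuousOn h (closedBall 0 1))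
    (hg : ContinuousOn g (closedBall 0 1)) :
    prodL1Norm h g = 2 * π * circleAverage (fun z => ‖h z * g z‖) 0 1 := by
  simp only [prodL1Norm, boundaryValue_eq_of_continuousOn (F := fun z => h z * g z) (hh.mul hg),
    circleAverage_def, smul_eq_mul, mul_inv_cancel_left₀ two_pi_pos.ne']

namespace IsCanonicalDecomposition

theorem harmonicOnNhd (hd : IsCanonicalDecomposition f h g) :
    InnerProductSpace.HarmonicOnNhd f (ball (0 : ℂ) 1) := fun z hz => by
  have hball := isOpen_ball.mem_nhds hz
  refine (InnerProductSpace.harmonicAt_congr_nhds (eventually_of_mem hball hd.eq_on_disk)).2 ?_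
  exact (hd.analytic_h.analyticAt hball).harmonicAt.add
    (hd.analytic_g.analyticAt hball).harmonicAt_conj

theorem memHarmonicHardy_two (hd : IsCanonicalDecomposition f h g)
    (hf : ContinuousOn f (closedBall 0 1)) : MemHarmonicHardy 2 f where
  harmonic := hd.harmonicOnNhd
  bounded := by
    obtain ⟨K, hK⟩ := (isCompact_closedBall (0 : ℂ) 1).exists_bound_of_continuousOn hf
    have hK0 : 0 ≤ K := (norm_nonneg _).trans (hK 0 (by simp))
    refine ⟨K, fun r h0 h1 => le_of_sq_le_sq ?_ hK0⟩
    have hsphere : sphere (0 : ℂ) |r| ⊆ closedBall 0 1 :=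
      sphere_subset_closedBall.trans
        (closedBall_subset_closedBall ((abs_of_nonneg h0).trans_le h1.le))
    rw [integralMean_two_sq]
    exact circleAverage_mono_on_of_le_circle
      ((hf.mono hsphere).norm.pow 2).circleIntegrable' fun z hz =>
        pow_le_pow_left₀ (norm_nonneg _) (hK z (hsphere hz)) 2

end IsCanonicalDecomposition

end ContinuousBoundary

section LogarithmicIntegrals

open Real

theorem le_integral_sq_div_sub {δ : ℝ} (hδ : 0 < δ) :
    -4 * log δ - 8 ≤ ∫ x in (-1 : ℝ)..1, (1 + x) ^ 2 / (1 + δ - x) := by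
  have hpos (x : ℝ) (hx : x ∈ Set.Icc (-1 : ℝ) 1) : 0 < 1 + δ - x := by linarith [hx.2]
  have hle : (-1 : ℝ) ≤ 1 := by norm_num
  have hint (F : ℝ → ℝ) (hF : Continuous F) :
      IntervalIntegrable (fun x => F x / (1 + δ - x)) volume (-1) 1 :=
    (hF.continuousOn.div (by fun_prop) fun x hx =>
      (hpos x (by rwa [← Set.uIcc_of_le hle])).ne').intervalIntegrable
  have hint4 : IntervalIntegrable (fun x => 4 / (1 + δ - x) - 4) volume (-1) 1 :=
    (hint _ continuous_const).sub intervalIntegrable_const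
  have hprim : ∫ x in (-1 : ℝ)..1, (4 / (1 + δ - x) - 4)
      = (-4 * log (1 + δ - 1) - 4 * 1) - (-4 * log (1 + δ - -1) - 4 * (-1)) := by
    refine intervalIntegral.integral_eq_sub_of_hasDerivAt
      (f := fun x => -4 * log (1 + δ - x) - 4 * x) (fun x hx => ?_) hint4
    rw [Set.uIcc_of_le hle] at hx
    convert! ((((hasDerivAt_id x).const_sub (1 + δ)).log (hpos x hx).ne').const_mul (-4)).sub
      ((hasDerivAt_id x).const_mul 4) using 1
    simp only [id_eq]
    ring
  calc -4 * log δ - 8 ≤ ∫ x in (-1 : ℝ)..1, (4 / (1 + δ - x) - 4) := by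
        rw [hprim, add_sub_cancel_left]
        linarith [log_nonneg (show 1 ≤ 1 + δ - -1 by linarith)]
    _ ≤ ∫ x in (-1 : ℝ)..1, (1 + x) ^ 2 / (1 + δ - x) := by
        refine intervalIntegral.integral_mono_on hle hint4 (hint _ (by fun_prop)) fun x hx => ?_
        rw [sub_le_iff_le_add, div_add' _ _ _ (hpos x hx).ne']
        refine div_le_div_of_nonneg_right ?_ (hpos x hx).le
        nlinarith [hx.1, hx.2]

theorem hasDerivAt_log_tan_div_four {θ : ℝ} (hθ : θ ∈ Set.Ioo 0 (2 * π)) :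
    HasDerivAt (fun θ => log (tan (θ / 4))) (2 * sin (θ / 2))⁻¹ θ := by
  have hsin : 0 < sin (θ / 4) :=
    sin_pos_of_pos_of_lt_pi (by linarith [hθ.1]) (by linarith [hθ.2, pi_pos])
  have hcos : 0 < cos (θ / 4) :=
    cos_pos_of_mem_Ioo ⟨by linarith [hθ.1, pi_pos], by linarith [hθ.2]⟩
  have htan : HasDerivAt (fun θ => tan (θ / 4)) (1 / cos (θ / 4) ^ 2 * (1 / 4)) θ :=
    HasDerivAt.comp (h := fun θ : ℝ => θ / 4) θ (hasDerivAt_tan hcos.ne')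
      ((hasDerivAt_id θ).div_const 4)
  convert! htan.log (by rw [tan_eq_sin_div_cos]; positivity) using 1
  rw [show θ / 2 = 2 * (θ / 4) by ring, sin_two_mul, tan_eq_sin_div_cos]
  field_simp
  ring

theorem intervalIntegrable_inv_two_mul_sin_half {a b : ℝ} (ha : 0 < a) (hab : a ≤ b)
    (hb : b < 2 * π) : IntervalIntegrable (fun θ => (2 * sin (θ / 2))⁻¹) volume a b := by
  refine (ContinuousOn.inv₀ (by fun_prop) fun θ hθ => ?_).intervalIntegrable
  rw [Set.uIcc_of_le hab] at hθ
  have := sin_pos_of_pos_of_lt_pi (x := θ / 2) (by linarith [hθ.1]) (by linarith [hθ.2])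
  positivity

theorem integral_inv_two_mul_sin_half {a b : ℝ} (ha : 0 < a) (hab : a ≤ b) (hb : b < 2 * π) :
    ∫ θ in a..b, (2 * sin (θ / 2))⁻¹ = log (tan (b / 4)) - log (tan (a / 4)) := by
  refine intervalIntegral.integral_eq_sub_of_hasDerivAt
    (f := fun θ => log (tan (θ / 4))) (fun θ hθ => ?_)
    (intervalIntegrable_inv_two_mul_sin_half ha hab hb)
  rw [Set.uIcc_of_le hab] at hθ
  exact hasDerivAt_log_tan_div_four ⟨ha.trans_le hθ.1, hθ.2.trans_lt hb⟩

theorem integral_inv_two_mul_sin_half_le {δ : ℝ} (hδ : 0 < δ) (hδπ : δ ≤ π) :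
    ∫ θ in δ..π, (2 * sin (θ / 2))⁻¹ ≤ -log δ + log 4 := by
  have htan : δ / 4 < tan (δ / 4) := lt_tan (by linarith) (by linarith [pi_pos])
  have hlog : log (δ / 4) ≤ log (tan (δ / 4)) := log_le_log (by linarith) htan.le
  rw [log_div hδ.ne' (by norm_num)] at hlog
  rw [integral_inv_two_mul_sin_half hδ hδπ (by linarith [pi_pos]), tan_pi_div_four, log_one]
  linarith

theorem sub_norm_le_norm_ofReal_sub (R : ℝ) (z : ℂ) : R - ‖z‖ ≤ ‖(R : ℂ) - z‖ :=
  (sub_le_sub_right (le_abs_self R) _).trans (by simpa using norm_sub_norm_le (R : ℂ) z)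

theorem two_mul_sin_half_le_norm_sub_circleMap {R : ℝ} (hR : 1 ≤ R) (θ : ℝ) :
    2 * sin (θ / 2) ≤ ‖(R : ℂ) - circleMap 0 1 θ‖ := by
  refine le_of_sq_le_sq ?_ (norm_nonneg _)
  have hcos : cos θ = 1 - 2 * sin (θ / 2) ^ 2 := by
    rw [← mul_div_cancel₀ θ two_ne_zero, cos_two_mul, cos_sq', mul_div_cancel₀ θ two_ne_zero]
    ring
  rw [circleMap_zero, Complex.ofReal_one, one_mul, norm_sub_rev, norm_exp_mul_I_sub_ofReal_sq, hcos]
  nlinarith [sq_nonneg (sin (θ / 2))]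

theorem norm_ofReal_sub_circleMap_pos {R : ℝ} (hR : 1 < R) (θ : ℝ) :
    0 < ‖(R : ℂ) - circleMap 0 1 θ‖ :=
  (sub_pos.2 hR).trans_le (by simpa using sub_norm_le_norm_ofReal_sub R (circleMap 0 1 θ))

theorem continuous_inv_norm_sub_circleMap {R : ℝ} (hR : 1 < R) :
    Continuous fun θ : ℝ => ‖(R : ℂ) - circleMap 0 1 θ‖⁻¹ :=
  Continuous.inv₀ (by fun_prop) fun θ => (norm_ofReal_sub_circleMap_pos hR θ).ne'

theorem integral_inv_norm_sub_circleMap_pos {R : ℝ} (hR : 1 < R) :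
    0 < ∫ θ in (0 : ℝ)..π, ‖(R : ℂ) - circleMap 0 1 θ‖⁻¹ :=
  intervalIntegral.intervalIntegral_pos_of_pos
    ((continuous_inv_norm_sub_circleMap hR).intervalIntegrable _ _)
    (fun θ => inv_pos.2 (norm_ofReal_sub_circleMap_pos hR θ)) pi_pos

theorem integral_inv_norm_sub_circleMap_le {δ : ℝ} (hδ : 0 < δ) (hδπ : δ < π) :
    ∫ θ in (0 : ℝ)..π, ‖((1 + δ : ℝ) : ℂ) - circleMap 0 1 θ‖⁻¹ ≤ -log δ + (1 + log 4) := by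
  have hint (a b : ℝ) :
      IntervalIntegrable (fun θ => ‖((1 + δ : ℝ) : ℂ) - circleMap 0 1 θ‖⁻¹) volume a b :=
    (continuous_inv_norm_sub_circleMap (by linarith)).intervalIntegrable a b
  have hnear : ∫ θ in (0 : ℝ)..δ, ‖((1 + δ : ℝ) : ℂ) - circleMap 0 1 θ‖⁻¹ ≤ 1 := by
    calc ∫ θ in (0 : ℝ)..δ, ‖((1 + δ : ℝ) : ℂ) - circleMap 0 1 θ‖⁻¹
        ≤ ∫ _ in (0 : ℝ)..δ, δ⁻¹ :=
          intervalIntegral.integral_mono_on hδ.le (hint _ _) intervalIntegrable_const fun θ _ =>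
            inv_anti₀ hδ (by
              simpa using sub_norm_le_norm_ofReal_sub (1 + δ) (circleMap 0 1 θ))
      _ = 1 := by simp [hδ.ne']
  have hfar : ∫ θ in δ..π, ‖((1 + δ : ℝ) : ℂ) - circleMap 0 1 θ‖⁻¹ ≤ -log δ + log 4 := by
    refine (intervalIntegral.integral_mono_on hδπ.le (hint _ _)
      (intervalIntegrable_inv_two_mul_sin_half hδ hδπ.le (by linarith)) fun θ hθ => ?_).trans
      (integral_inv_two_mul_sin_half_le hδ hδπ.le)
    have hsin := sin_pos_of_pos_of_lt_pi (x := θ / 2) (by linarith [hθ.1])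
      (by linarith [hθ.2, pi_pos])
    exact inv_anti₀ (by positivity) (two_mul_sin_half_le_norm_sub_circleMap (by linarith) θ)
  rw [← intervalIntegral.integral_add_adjacent_intervals (hint 0 δ) (hint δ π)]
  linarith

end LogarithmicIntegrals

section Extremal

open Metric Real
open scoped ComplexConjugate

variable {R : ℝ} {c : ℂ}

theorem circleAverage_comp_mul {E : Type*} [NormedAddCommGroup E] [NormedSpace ℝ E] (F : ℂ → E)
    (hc : ‖c‖ = 1) (r : ℝ) : circleAverage (fun z => F (c * z)) 0 r = circleAverage F 0 r := by
  have hexp : Complex.exp (c.arg * Complex.I) = c := by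
    simpa [hc] using Complex.norm_mul_exp_arg_mul_I c
  rw [circleAverage_eq_integral_add (f := F) c.arg, circleAverage_def]
  simp only [circleMap_zero, Complex.ofReal_add, add_mul, Complex.exp_add, hexp, mul_comm c,
    mul_assoc]

/-- The analytic part of the near-extremal function: a square root of the kernel `1 / (R - c z)`,
whose singularity `R / c` approaches the unit circle as `R` decreases to `1`. -/
def extremalAnalytic (R : ℝ) (c z : ℂ) : ℂ := ((R - c * z) ^ (2 : ℂ)⁻¹)⁻¹

/-- The conjugate of the co-analytic part of the near-extremal function. It has the modulus of
`extremalAnalytic` on the unit circle, which gives equality in the second inequality. -/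
def extremalCoanalytic (R : ℝ) (c z : ℂ) : ℂ := c * z * extremalAnalytic R c z

/-- The near-extremal harmonic function. -/
def extremalHarmonic (R : ℝ) (c z : ℂ) : ℂ :=
  extremalAnalytic R c z + conj (extremalCoanalytic R c z)

theorem extremalAnalytic_sq (R : ℝ) (c z : ℂ) : extremalAnalytic R c z ^ 2 = (R - c * z)⁻¹ := by
  rw [extremalAnalytic, inv_pow, Complex.cpow_ofNat_inv_pow]

theorem norm_extremalAnalytic_sq (R : ℝ) (c z : ℂ) :
    ‖extremalAnalytic R c z‖ ^ 2 = ‖R - c * z‖⁻¹ := by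
  rw [← norm_pow, extremalAnalytic_sq, norm_inv]

theorem norm_extremalCoanalytic (hc : ‖c‖ = 1) {z : ℂ} (hz : ‖z‖ = 1) :
    ‖extremalCoanalytic R c z‖ = ‖extremalAnalytic R c z‖ := by
  rw [extremalCoanalytic, norm_mul, norm_mul, hc, hz, one_mul, one_mul]

theorem diffContOnCl_extremalAnalytic (hR : 1 < R) (hc : ‖c‖ = 1) :
    DiffContOnCl ℂ (extremalAnalytic R c) (ball 0 1) := by
  refine DifferentiableOn.diffContOnCl fun z hz => DifferentiableAt.differentiableWithinAt ?_
  have hz1 : ‖z‖ ≤ 1 := mem_closedBall_zero_iff.1 (closure_ball_subset_closedBall hz)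
  have hslit : (R : ℂ) - c * z ∈ Complex.slitPlane := Or.inl (by
    have hre : (c * z).re ≤ ‖z‖ := by simpa [hc] using Complex.re_le_norm (c * z)
    rw [Complex.sub_re, Complex.ofReal_re]
    linarith)
  exact (DifferentiableAt.cpow_const (f := fun z => R - c * z) (by fun_prop) hslit).inv
    (Complex.cpow_ne_zero_iff.2 (Or.inl (Complex.slitPlane_ne_zero hslit)))

theorem diffContOnCl_extremalCoanalytic (hR : 1 < R) (hc : ‖c‖ = 1) :
    DiffContOnCl ℂ (extremalCoanalytic R c) (ball 0 1) :=
  (differentiable_id.const_mul c).diffContOnCl.smul (diffContOnCl_extremalAnalytic hR hc)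

theorem continuousOn_extremalHarmonic (hR : 1 < R) (hc : ‖c‖ = 1) :
    ContinuousOn (extremalHarmonic R c) (closedBall 0 1) :=
  (diffContOnCl_extremalAnalytic hR hc).continuousOn_ball.add
    (Complex.continuous_conj.comp_continuousOn
      (diffContOnCl_extremalCoanalytic hR hc).continuousOn_ball)

theorem isCanonicalDecomposition_extremal (hR : 1 < R) (hc : ‖c‖ = 1) :
    IsCanonicalDecomposition (extremalHarmonic R c) (extremalAnalytic R c)
      (extremalCoanalytic R c) where
  analytic_h := (diffContOnCl_extremalAnalytic hR hc).differentiableOn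
  analytic_g := (diffContOnCl_extremalCoanalytic hR hc).differentiableOn
  normalized := by rw [extremalCoanalytic, mul_zero, zero_mul]
  eq_on_disk _ _ := rfl

theorem prodL1Norm_extremal (hR : 1 < R) (hc : ‖c‖ = 1) :
    prodL1Norm (extremalAnalytic R c) (extremalCoanalytic R c)
      = 2 * ∫ θ in (0 : ℝ)..π, ‖(R : ℂ) - circleMap 0 1 θ‖⁻¹ := by
  have hconj (θ : ℝ) : ‖(R : ℂ) - circleMap 0 1 (-θ)‖ = ‖(R : ℂ) - circleMap 0 1 θ‖ := by
    rw [← RCLike.norm_conj, map_sub, Complex.conj_ofReal, conj_circleMap]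
    simp
  have hcont : ContinuousOn (fun z : ℂ => ‖R - z‖⁻¹) (sphere 0 |1|) := by
    refine ContinuousOn.inv₀ (by fun_prop) fun z hz => ne_of_gt ?_
    rw [abs_one, mem_sphere_zero_iff_norm] at hz
    exact (sub_pos.2 (hz ▸ hR)).trans_le (sub_norm_le_norm_ofReal_sub R z)
  have hsymm := integral_comp_circleMap_add_comp_circleMap_neg hcont
  simp only [hconj, ← two_mul, intervalIntegral.integral_const_mul] at hsymm
  rw [hsymm, prodL1Norm_eq_circleAverage (diffContOnCl_extremalAnalytic hR hc).continuousOn_ball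
    (diffContOnCl_extremalCoanalytic hR hc).continuousOn_ball,
    circleAverage_congr_sphere (f₂ := fun z => ‖R - c * z‖⁻¹) fun z hz => ?_,
    circleAverage_comp_mul (fun z => ‖R - z‖⁻¹) hc, circleAverage_def, smul_eq_mul,
    mul_inv_cancel_left₀ two_pi_pos.ne']
  rw [abs_one, mem_sphere_zero_iff_norm] at hz
  simp only [norm_mul, norm_extremalCoanalytic hc hz, ← sq, norm_extremalAnalytic_sq]

theorem boundarySqIntegral_extremal (hR : 1 < R) (hc : ‖c‖ = 1) :
    boundarySqIntegral (extremalHarmonic R c)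
      = 2 * prodL1Norm (extremalAnalytic R c) (extremalCoanalytic R c) := by
  have hh := diffContOnCl_extremalAnalytic hR hc
  have hg := diffContOnCl_extremalCoanalytic hR hc
  have hnorm : Set.EqOn (fun z => ‖extremalCoanalytic R c z‖) (fun z => ‖extremalAnalytic R c z‖)
      (sphere 0 |1|) := fun z hz => by
    rw [abs_one, mem_sphere_zero_iff_norm] at hz
    exact norm_extremalCoanalytic hc hz
  rw [boundarySqIntegral_eq_circleAverage (continuousOn_extremalHarmonic hR hc),
    prodL1Norm_eq_circleAverage hh.continuousOn_ball hg.continuousOn_ball]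
  rw [← abs_one] at hh hg
  simp only [extremalHarmonic]
  rw [circleAverage_norm_add_conj_sq hh hg (isCanonicalDecomposition_extremal hR hc).normalized
      one_ne_zero,
    circleAverage_congr_sphere (f₁ := fun z => ‖extremalCoanalytic R c z‖ ^ 2)
      (f₂ := fun z => ‖extremalAnalytic R c z‖ ^ 2) fun z hz => by simp only [hnorm hz],
    circleAverage_congr_sphere (f₁ := fun z => ‖extremalAnalytic R c z * extremalCoanalytic R c z‖)
      (f₂ := fun z => ‖extremalAnalytic R c z‖ ^ 2) fun z hz => by
        simp only [norm_mul, hnorm hz, sq]]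
  ring

theorem diameterIntegral_extremal (hR : 1 < R) (t : ℝ) :
    diameterIntegral (extremalHarmonic R (Complex.exp (-(t * Complex.I)))) t
      = ∫ x in (-1 : ℝ)..1, (1 + x) ^ 2 / (R - x) := by
  refine intervalIntegral.integral_congr fun x hx => ?_
  rw [Set.uIcc_of_le (by norm_num)] at hx
  have hpos : 0 < R - x := by linarith [hx.2]
  set c : ℂ := Complex.exp (-(t * Complex.I)) with hc
  set z : ℂ := x * Complex.exp (t * Complex.I)
  have hcz : c * z = x := by
    rw [mul_left_comm, hc, ← Complex.exp_add, neg_add_cancel, Complex.exp_zero, mul_one]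
  have hsq : extremalAnalytic R c z ^ 2 = ((R - x)⁻¹ : ℝ) := by
    rw [extremalAnalytic_sq, hcz]
    push_cast
    rfl
  have hnorm : ‖extremalAnalytic R c z‖ ^ 2 = (R - x)⁻¹ := by
    rw [← norm_pow, hsq, Complex.norm_real, norm_of_nonneg (inv_pos.2 hpos).le]
  have hprod : extremalAnalytic R c z * (x * extremalAnalytic R c z) = (x * (R - x)⁻¹ : ℝ) := by
    rw [mul_left_comm, ← sq, hsq, Complex.ofReal_mul]
  simp only [extremalHarmonic, extremalCoanalytic]
  rw [norm_add_conj_sq, hcz, hprod, norm_mul, mul_pow, hnorm, Complex.ofReal_re,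
    Complex.norm_real, norm_eq_abs, sq_abs]
  ring

theorem exists_near_extremal (t : ℝ) {C : ℝ} (hC : C < 1) :
    ∃ f h g : ℂ → ℂ, MemHarmonicHardy 2 f ∧ IsCanonicalDecomposition f h g ∧
      C * (1 / 2 * boundarySqIntegral f + prodL1Norm h g) < diameterIntegral f t ∧
      C * boundarySqIntegral f < 1 / 2 * boundarySqIntegral f + prodL1Norm h g := by
  have hlog4 : 0 < log 4 := log_pos (by norm_num)
  obtain ⟨D, hD0, hCD, hD1⟩ : ∃ D, 0 ≤ D ∧ C ≤ D ∧ D < 1 :=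
    ⟨max C 0, le_max_right _ _, le_max_left _ _, max_lt hC zero_lt_one⟩
  obtain ⟨L, hL0, hL⟩ : ∃ L > 0, D * (L + (1 + log 4)) < L - 2 := by
    refine ⟨(3 + log 4) / (1 - D), div_pos (by linarith) (by linarith), ?_⟩
    have hmul := div_mul_cancel₀ (3 + log 4) (sub_pos.2 hD1).ne'
    have hlt := mul_lt_of_lt_one_left (show 0 < 1 + log 4 by linarith) hD1
    linarith
  set δ : ℝ := exp (-L) with hδ
  have hδ0 : 0 < δ := exp_pos _
  have hδπ : δ < π := (exp_lt_one_iff.2 (neg_neg_of_pos hL0)).trans (by linarith [pi_gt_three])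
  have hR : 1 < 1 + δ := lt_add_of_pos_right 1 hδ0
  have hc : ‖Complex.exp (-(t * Complex.I))‖ = 1 := by simp [Complex.norm_exp]
  have hd := isCanonicalDecomposition_extremal hR hc
  refine ⟨_, _, _, hd.memHarmonicHardy_two (continuousOn_extremalHarmonic hR hc), hd, ?_⟩
  have hdiam := le_integral_sq_div_sub hδ0
  have hJ := integral_inv_norm_sub_circleMap_le hδ0 hδπ
  rw [boundarySqIntegral_extremal hR hc, prodL1Norm_extremal hR hc,
    diameterIntegral_extremal hR t]
  rw [hδ, log_exp, neg_neg, ← hδ] at hJ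
  rw [hδ, log_exp, ← hδ] at hdiam
  have hJ0 := integral_inv_norm_sub_circleMap_pos hR
  generalize (∫ θ in (0 : ℝ)..π, ‖((1 + δ : ℝ) : ℂ) - circleMap 0 1 θ‖⁻¹) = J at hJ hJ0 ⊢
  have hCJ : C * J ≤ D * (L + (1 + log 4)) :=
    (mul_le_mul_of_nonneg_right hCD hJ0.le).trans (mul_le_mul_of_nonneg_left hJ hD0)
  have hCJ' : C * J < J := mul_lt_of_lt_one_left hJ0 hC
  exact ⟨by linarith, by linarith⟩

end Extremal

end

theorem theorem3 :
    (∀ f h g : ℂ → ℂ, MemHarmonicHardy 2 f → IsCanonicalDecomposition f h g →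
      (∀ᵐ θ : ℝ, ∃ w : ℂ, HasRadialLimit f θ w) ∧
      (∀ᵐ θ : ℝ, ∃ w : ℂ, HasRadialLimit (fun z => h z * g z) θ w) ∧
      IntervalIntegrable (fun θ : ℝ => ‖boundaryValue f θ‖ ^ 2) volume 0 (2 * Real.pi) ∧
      IntervalIntegrable (fun θ : ℝ => ‖boundaryValue (fun z => h z * g z) θ‖)
        volume 0 (2 * Real.pi) ∧
      ∀ t : ℝ,
        IntervalIntegrable
          (fun x : ℝ => ‖f ((x : ℂ) * Complex.exp ((t : ℂ) * Complex.I))‖ ^ 2) volume (-1) 1 ∧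
        diameterIntegral f t ≤ (1 / 2) * boundarySqIntegral f + prodL1Norm h g ∧
        (1 / 2) * boundarySqIntegral f + prodL1Norm h g ≤ boundarySqIntegral f) ∧
    (∀ t C : ℝ, C < 1 →
      ∃ f h g : ℂ → ℂ, MemHarmonicHardy 2 f ∧ IsCanonicalDecomposition f h g ∧
        C * ((1 / 2) * boundarySqIntegral f + prodL1Norm h g) < diameterIntegral f t ∧
        C * boundarySqIntegral f < (1 / 2) * boundarySqIntegral f + prodL1Norm h g) := by
  refine ⟨fun f h g hf hd => ?_, fun t C hC => exists_near_extremal t hC⟩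
  obtain ⟨φ, γ, hφ, hγ⟩ := hd.exists_hasL2BoundaryFunction hf
  refine ⟨?_, ?_, hd.intervalIntegrable_norm_sq_boundaryValue hφ hγ _ _,
    hφ.intervalIntegrable_norm_boundaryValue_mul hγ _ _, fun t => ?_⟩
  · exact (hd.ae_hasRadialLimit hφ hγ).mono fun θ hθ => ⟨_, hθ⟩
  · exact (hφ.ae_hasRadialLimit_mul hγ).mono fun θ hθ => ⟨_, hθ⟩
  · obtain ⟨hint, hle⟩ := intervalIntegrable_and_diameterIntegral_le hd hφ hγ t
    exact ⟨hint, hle, half_boundarySqIntegral_add_prodL1Norm_le hd hφ hγ⟩
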